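/- **Theorem (security of DQ-OT).** *Setting.* All algorithms are non-uniform probabilistic polynomial time (PPT), i.e. polynomial-size families of probabilistic circuits which can draw uniform elements of $\{0,\dots,N-1\}$ for $N$ given in binary. Let $\mathsf G$ be a group generator: on input $1^\lambda$ it outputs in polynomial time a description $(\mathbb G,p,g)$ of a cyclic group $\mathbb G=\langle g\rangle$ whose order $p$ is a $\lambda$-bit prime, whose elements have unique representations as bit strings, and in which multiplication and inversion take polynomial time. The discrete logarithm (DL) assumption for $\mathsf G$ says that every PPT algorithm, given $(\mathbb G,p,g,g^{a})$ with $a\leftarrow\mathbb Z_p$ uniform, outputs $a$ with only negligible probability in $\lambda$; the computational Diffie–Hellman (CDH) assumption says that every PPT algorithm, given $(\mathbb G,p,g,g^{a},g^{b})$ with $a,b\leftarrow\mathbb Z_p$ uniform and independent, outputs $g^{ab}$ with only negligible probability. Let $\sigma=\sigma(\lambda)$ be a polynomially bounded message length, and let $\mathtt H:\{0,1\}^*\to\{0,1\}^\sigma$ be a random oracle. *The protocol DQ-OT.* The parties are a sender $S$ with messages $m_0,m_1\in\{0,1\}^\sigma$, two proxies $P_1,P_2$ without input, and a receiver $R$ with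 an index $s\in\{0,1\}$. 1. $S$ generates $(\mathbb G,p,g)$ with $\mathsf G(1^\lambda)$, draws a uniform $a\in\mathbb Z_p$ and publishes $pk=(C,p,g)$, with the description of $\mathbb G$, where $C=g^{a}$. 2. $R$ draws a uniform bit $s_1$, sets $s_2=s_1\oplus s$, draws uniform $r_1,r_2\in\mathbb Z_p$, and sends $(s_i,r_i)$ to $P_i$ for $i=1,2$. 3. $P_2$ sends $(\delta_0,\delta_1)$ to $P_1$, where $\delta_{s_2}=g^{r_2}$ and $\delta_{1-s_2}=C/g^{r_2}$. 4. $P_1$ sends $(\beta_0,\beta_1)$ to $S$, where $\beta_{s_1}=\delta_0\cdot g^{r_1}$ and $\beta_{1-s_1}=\delta_1/g^{r_1}$. 5. $S$ aborts if $\beta_0\beta_1\ne C$. Otherwise it draws uniform $y_0,y_1\in\mathbb Z_p$ and sends $e_i=(e_{i,0},e_{i,1})=(g^{y_i},\mathtt H(\beta_i^{y_i})\oplus m_i)$, $i=0,1$, to $R$. 6. $R$ sets $x=r_2+r_1(-1)^{s_2}$ and outputs $\mathtt H(e_{s,0}^{\,x})\oplus e_{s,1}$. *Claim.* Suppose that the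 DL and CDH assumptions hold for $\mathsf G$. Then in the random oracle model DQ-OT securely realises the delegated-query OT functionality $\mathcal F:((m_0,m_1),\epsilon,\epsilon,s)\mapsto(\epsilon,\epsilon,\epsilon,m_s)$ in the presence of semi-honest non-colluding adversaries. That is: * (Correctness.) In every execution $R$ outputs $m_s$. * (Security.) For each party $P\in\{S,P_1,P_2,R\}$ there is a PPT simulator $\mathtt{Sim}_P$ with query access to $\mathtt H$ which, given only the input of $P$ and its output from $\mathcal F$, produces a string that is computationally indistinguishable from the view of $P$ in a real execution. Here the view consists of the party's input, its random coins, $pk$, and all messages that it receives, together with the output for $R$. Indistinguishability means that for every PPT distinguisher with query access to the same $\mathtt H$ there is a negligible function $\mu$ such that for all $\lambda$, $m_0,m_1\in\{0,1\}^{\sigma}$ and $s\in\{0,1\}$ the distinguishing advantage is at most $\mu(\lambda)$. -/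

import Mathlib

open MeasureTheory

namespace DQOT

/-! ### Non-uniform probabilistic polynomial time, with oracle access

An algorithm for security parameter `n` is a probabilistic Boolean circuit with oracle gates,
written as a straight-line program over one-bit registers. A non-uniform PPT algorithm is a family
of such circuits, one for each `n`, of polynomially bounded size. -/

/-- An oracle answers a bit string with a bit string. -/
abbrev Oracle := List Bool → List Bool

/-- The oracle that answers every query with the empty string: no oracle at all. -/
def noOracle : Oracle := fun _ => []

/-- Fixed-length bit strings. -/
abbrev Bits (k : ℕ) := Fin k → Bool

/-- Bitwise exclusive or. -/
def bxor {k : ℕ} (u v : Bits k) : Bits k := fun i => xor (u i) (v i)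

/-- The `k` low-order bits of `x`, least significant bit first. -/
def natToBits (k x : ℕ) : List Bool := List.ofFn fun i : Fin k => x.testBit i

/-- The natural number with the given binary digits, least significant bit first. -/
def bitsToNat (w : List Bool) : ℕ := Nat.ofDigits 2 (w.map Bool.toNat)

/-- Gates. Registers are numbered by natural numbers and hold one bit each. -/
inductive Gate where
  /-- `r := b` -/
  | const (r : ℕ) (b : Bool)
  /-- `r := ¬ (a ∧ b)` -/
  | nand (r a b : ℕ)
  /-- Read a number `N` in binary from the registers `src`, draw a fresh uniformly random element
  of `{0, …, N - 1}`, and write it in binary to the registers `dst`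
  (with `N = 2` and one register in `dst` this is a fair coin). -/
  | sample (dst src : List ℕ)
  /-- Query the oracle on the bits in `src`, and write the answer to `dst`. -/
  | query (dst src : List ℕ)

/-- The size of a gate is one plus the number of registers listed in it. -/
def Gate.size : Gate → ℕ
  | .const _ _ => 2
  | .nand _ _ _ => 4
  | .sample dst src => 1 + dst.length + src.length
  | .query dst src => 1 + dst.length + src.length

/-- Register contents. -/
abbrev Memory := ℕ → Bool

/-- The input is placed in registers `0, 1, 2, …`; all other registers are `false`. -/
def Memory.load (w : List Bool) : Memory := fun i => w.getD i false

def Memory.write (M : Memory) (dst : List ℕ) (w : List Bool) : Memory :=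
  (dst.zip w).foldl (fun M' e => Function.update M' e.1 e.2) M

/-- The uniform distribution on `{0, …, N - 1}` (and the point mass at `0` if `N = 0`). -/
noncomputable def uniformBelow (N : ℕ) : PMF ℕ :=
  PMF.uniformOfFinset (Finset.range (max N 1)) ⟨0, by simp⟩

noncomputable def Gate.step (O : Oracle) (M : Memory) : Gate → PMF Memory
  | .const r b => PMF.pure (Function.update M r b)
  | .nand r a b => PMF.pure (Function.update M r (!(M a && M b)))
  | .sample dst src =>
      (uniformBelow (bitsToNat (src.map M))).map fun x => M.write dst (natToBits dst.length x)
  | .query dst src => PMF.pure (M.write dst (O (src.map M)))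

/-- Execute gates in order. -/
noncomputable def runGates (O : Oracle) : List Gate → Memory → PMF Memory
  | [], M => PMF.pure M
  | e :: es, M => (e.step O M).bind (runGates O es)

/-- A circuit: a list of gates, executed in order, and the number of output bits; the output is
read from registers `0, …, outLen - 1`. -/
structure Circuit where
  gates : List Gate
  outLen : ℕ

def Circuit.size (A : Circuit) : ℕ := A.outLen + (A.gates.map Gate.size).sum

/-- The output distribution of a circuit on input `w` with oracle `O`. -/
noncomputable def Circuit.run (A : Circuit) (O : Oracle) (w : List Bool) : PMF (List Bool) :=
  (runGates O A.gates (Memory.load w)).map fun M => (List.range A.outLen).map M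

def PolyBounded (f : ℕ → ℕ) : Prop := ∃ P : Polynomial ℕ, ∀ n, f n ≤ P.eval n

/-- A non-uniform PPT algorithm is a family of circuits of polynomially bounded size. -/
def IsPPT (A : ℕ → Circuit) : Prop := PolyBounded fun n => (A n).size

/-- `μ` is negligible: `n ^ k * μ n → 0` for every `k`. -/
def Negligible (μ : ℕ → ℝ) : Prop :=
  Asymptotics.SuperpolynomialDecay Filter.atTop (fun n : ℕ => (n : ℝ)) μ

/-! ### The random oracle -/

/-- Hash functions `{0,1}^* → {0,1}^k`. -/
abbrev Hash (k : ℕ) := List Bool → Bits k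

/-- A uniformly random function `{0,1}^* → {0,1}^k`: the values at distinct strings are independent
and uniform. -/
noncomputable def randomOracle (k : ℕ) : Measure (Hash k) :=
  Measure.infinitePi fun _ : List Bool => (PMF.uniformOfFintype (Bits k)).toMeasure

/-- Oracle access to a hash function. -/
def Hash.toOracle {k : ℕ} (H : Hash k) : Oracle := fun w => List.ofFn (H w)

/-- The probability, over a random oracle `H` with `k`-bit values, that the circuit `D` with access
to `H` outputs the single bit `1` on a string drawn from `X H`. -/
noncomputable def acceptProb {k : ℕ} (D : Circuit) (X : Hash k → PMF (List Bool)) : ℝ :=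
  (∫⁻ H, ((X H).bind fun v => D.run H.toOracle v) [true] ∂(randomOracle k)).toReal

/-- Computational indistinguishability in the random oracle model of two ensembles of
distributions on bit strings, indexed by the security parameter `n` and by `i : ι n`:
every non-uniform PPT distinguisher has negligible advantage, uniformly in the index `i`. -/
def CompIndist (σ : ℕ → ℕ) {ι : ℕ → Type} (X Y : ∀ n, ι n → Hash (σ n) → PMF (List Bool)) :
    Prop :=
  ∀ D : ℕ → Circuit, IsPPT D → ∃ μ : ℕ → ℝ, Negligible μ ∧
    ∀ n (i : ι n), |acceptProb (D n) (X n i) - acceptProb (D n) (Y n i)| ≤ μ n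

/-! ### Group generators -/

/-- A group generator. On security parameter `n` it turns `coinLen n` fair coins into a
description `d` of a cyclic group of prime order with a fixed generator. For `n ≥ 2` the order is
a prime of exactly `n` bits (there is none for `n < 2`). Group elements have
unique representations by bit strings. The generator runs in polynomial time, and so do
multiplication and inversion in the groups that it outputs. -/
structure GroupGen where
  coinLen : ℕ → ℕ
  descLen : ℕ → ℕ
  eltLen : ℕ → ℕ
  /-- the description that results from given coins -/
  gen : ∀ n, Bits (coinLen n) → Bits (descLen n)
  /-- the group with description `d` -/
  Elt : ∀ n, Bits (descLen n) → Type
  [group : ∀ n d, CommGroup (Elt n d)]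
  /-- its order -/
  order : ∀ n, Bits (descLen n) → ℕ
  /-- its generator -/
  g : ∀ n d, Elt n d
  /-- its elements as bit strings -/
  enc : ∀ n d, Elt n d → Bits (eltLen n)
  order_prime : ∀ n d, (order n d).Prime
  card_elt : ∀ n d, Nat.card (Elt n d) = order n d
  order_size : ∀ n d, 2 ≤ n → 2 ^ (n - 1) ≤ order n d ∧ order n d < 2 ^ n
  g_generates : ∀ n d (h : Elt n d), h ∈ Subgroup.zpowers (g n d)
  enc_injective : ∀ n d, Function.Injective (enc n d)
  coinLen_poly : PolyBounded coinLen
  /-- the description, the order in binary and the generator are computed in polynomial time -/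
  gen_ppt : ∃ A : ℕ → Circuit, IsPPT A ∧ ∀ n (ρ : Bits (coinLen n)) (O : Oracle),
    (A n).run O (List.ofFn ρ) =
      PMF.pure (List.ofFn (gen n ρ) ++ natToBits n (order n (gen n ρ)) ++
        List.ofFn (enc n (gen n ρ) (g n (gen n ρ))))
  mul_ppt : ∃ A : ℕ → Circuit, IsPPT A ∧ ∀ n (ρ : Bits (coinLen n)) (O : Oracle)
    (h k : Elt n (gen n ρ)),
    (A n).run O (List.ofFn (gen n ρ) ++ List.ofFn (enc n _ h) ++ List.ofFn (enc n _ k)) =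
      PMF.pure (List.ofFn (enc n _ (h * k)))
  inv_ppt : ∃ A : ℕ → Circuit, IsPPT A ∧ ∀ n (ρ : Bits (coinLen n)) (O : Oracle)
    (h : Elt n (gen n ρ)),
    (A n).run O (List.ofFn (gen n ρ) ++ List.ofFn (enc n _ h)) =
      PMF.pure (List.ofFn (enc n _ h⁻¹))

namespace GroupGen

attribute [instance] GroupGen.group

variable (G : GroupGen)

/-- Exponents: the integers modulo the group order. -/
abbrev Expo (n : ℕ) (d : Bits (G.descLen n)) : Type := ZMod (G.order n d)

instance factPrime (n : ℕ) (d : Bits (G.descLen n)) : Fact (G.order n d).Prime :=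
  ⟨G.order_prime n d⟩

noncomputable instance fintypeExpo (n : ℕ) (d : Bits (G.descLen n)) : Fintype (G.Expo n d) :=
  inferInstanceAs (Fintype (ZMod (G.order n d)))

variable {G} {n : ℕ} {d : Bits (G.descLen n)}

/-- `h ^ x` for an exponent `x` modulo the group order. -/
def expo (h : G.Elt n d) (x : G.Expo n d) : G.Elt n d := h ^ x.val

/-- The bit string that represents a group element. -/
def eltBits (h : G.Elt n d) : List Bool := List.ofFn (G.enc n d h)

/-- An exponent in binary. -/
def expoBits (x : G.Expo n d) : List Bool := natToBits n x.val

variable (G)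

/-- `(𝔾, p, g)` as a bit string. -/
def paramBits (n : ℕ) (d : Bits (G.descLen n)) : List Bool :=
  List.ofFn d ++ natToBits n (G.order n d) ++ eltBits (G.g n d)

/-- The probability that `A`, given `(𝔾, p, g)` and `g ^ a` for uniform `a`, outputs `a`. -/
noncomputable def dlSuccess (A : Circuit) (n : ℕ) : ℝ :=
  (((PMF.uniformOfFintype (Bits (G.coinLen n))).bind fun ρ =>
    (PMF.uniformOfFintype (G.Expo n (G.gen n ρ))).bind fun a =>
      (A.run noOracle (G.paramBits n (G.gen n ρ) ++ eltBits (expo (G.g n (G.gen n ρ)) a))).map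
        fun out => decide (out = expoBits a)) true).toReal

/-- The discrete logarithm assumption. -/
def DLHard : Prop := ∀ A : ℕ → Circuit, IsPPT A → Negligible fun n => G.dlSuccess (A n) n

/-- The probability that `A`, given `(𝔾, p, g)`, `g ^ a` and `g ^ b` for independent uniform `a` and
`b`, outputs `g ^ (a * b)`. -/
noncomputable def cdhSuccess (A : Circuit) (n : ℕ) : ℝ :=
  (((PMF.uniformOfFintype (Bits (G.coinLen n))).bind fun ρ =>
    (PMF.uniformOfFintype (G.Expo n (G.gen n ρ))).bind fun a =>
    (PMF.uniformOfFintype (G.Expo n (G.gen n ρ))).bind fun b =>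
      (A.run noOracle (G.paramBits n (G.gen n ρ) ++ eltBits (expo (G.g n (G.gen n ρ)) a) ++
          eltBits (expo (G.g n (G.gen n ρ)) b))).map
        fun out => decide (out = eltBits (expo (G.g n (G.gen n ρ)) (a * b)))) true).toReal

/-- The computational Diffie–Hellman assumption. -/
def CDHHard : Prop := ∀ A : ℕ → Circuit, IsPPT A → Negligible fun n => G.cdhSuccess (A n) n

end GroupGen

/-! ### The delegated-query OT functionality and its secure realisation -/

/-- The sender, the two proxies, and the receiver. -/
inductive Party where
  | S
  | P₁
  | P₂
  | R

/-- The sender's messages `(m₀, m₁)`; `m false` is `m₀` and `m true` is `m₁`. -/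
abbrev Messages (k : ℕ) := Bool → Bits k

/-- The private input of each party. -/
def partyInput {k : ℕ} (m : Messages k) (s : Bool) : Party → List Bool
  | .S => List.ofFn (m false) ++ List.ofFn (m true)
  | .P₁ => []
  | .P₂ => []
  | .R => [s]

/-- The functionality `((m₀, m₁), ε, ε, s) ↦ (ε, ε, ε, m_s)`. -/
def functionality {k : ℕ} (m : Messages k) (s : Bool) : Party → List Bool
  | .S => []
  | .P₁ => []
  | .P₂ => []
  | .R => List.ofFn (m s)

/-- A protocol, given by the distribution of each party's view for each hash function and each
choice of inputs, realises the functionality in the presence of semi-honest non-colluding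
adversaries: for each party there is a non-uniform PPT simulator with access to the random oracle
that, given only the input and the output of that party, produces a string that is computationally
indistinguishable from the view, for distinguishers that access the same random oracle. -/
def Realizes (σ : ℕ → ℕ)
    (view : ∀ n, Party → Messages (σ n) → Bool → Hash (σ n) → PMF (List Bool)) : Prop :=
  ∀ P : Party, ∃ Sim : ℕ → Circuit, IsPPT Sim ∧
    CompIndist σ (ι := fun n => Messages (σ n) × Bool)
      (fun n i H => (Sim n).run H.toOracle (partyInput i.1 i.2 P ++ functionality i.1 i.2 P))
      (fun n i H => view n P i.1 i.2 H)

/-! ### The protocol -/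

section Protocol

open GroupGen

variable {G : GroupGen} {n : ℕ} {d : Bits (G.descLen n)} {k : ℕ}

/-- XOR sharing of the index `s` with the coin `b`. -/
def share (s b : Bool) : Bool × Bool := (b, xor b s)

/-- Query generation of `P₂`: `δ_{s₂} = g ^ r₂` and `δ_{1 - s₂} = C / g ^ r₂`. -/
def queryP₂ (C : G.Elt n d) (s₂ : Bool) (r₂ : G.Expo n d) : Bool → G.Elt n d := fun i =>
  if i = s₂ then expo (G.g n d) r₂ else C / expo (G.g n d) r₂

/-- Query generation of `P₁`: `β_{s₁} = δ₀ * g ^ r₁` and `β_{1 - s₁} = δ₁ / g ^ r₁`. -/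
def queryP₁ (δ : Bool → G.Elt n d) (s₁ : Bool) (r₁ : G.Expo n d) : Bool → G.Elt n d := fun i =>
  if i = s₁ then δ false * expo (G.g n d) r₁ else δ true / expo (G.g n d) r₁

open Classical in
/-- Response generation of `S`: abort if `C ≠ β₀ * β₁`, and otherwise return
`e_i = (g ^ y_i, H (β_i ^ y_i) ⊕ m_i)` for `i = 0, 1`. -/
noncomputable def respond (H : Hash k) (C : G.Elt n d) (β : Bool → G.Elt n d) (m : Messages k)
    (y : Bool → G.Expo n d) : Option (Bool → G.Elt n d × Bits k) :=
  if β false * β true = C then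
    some fun i => (expo (G.g n d) (y i), bxor (H (eltBits (expo (β i) (y i)))) (m i))
  else none

/-- Message extraction of `R`: `H (e_{s,0} ^ x) ⊕ e_{s,1}` with `x = r₂ + r₁ * (-1) ^ s₂`, where `s`
is the exclusive or of the two shares. -/
def retrieve (H : Hash k) (res : Bool → G.Elt n d × Bits k) (s₁ s₂ : Bool)
    (r₁ r₂ : G.Expo n d) : Bits k :=
  bxor (H (eltBits (expo (res (xor s₁ s₂)).1 (r₂ + r₁ * (-1) ^ s₂.toNat)))) (res (xor s₁ s₂)).2

variable (G n) in
/-- All the random choices in one execution. -/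
structure Coins where
  /-- `S`: coins of the group generator -/
  ρ : Bits (G.coinLen n)
  /-- `S`: exponent of the random group element `C = g ^ a` -/
  a : G.Expo n (G.gen n ρ)
  /-- `R`: coin of the XOR sharing -/
  b : Bool
  /-- `R`: random exponent for `P₁` -/
  r₁ : G.Expo n (G.gen n ρ)
  /-- `R`: random exponent for `P₂` -/
  r₂ : G.Expo n (G.gen n ρ)
  /-- `S`: random exponents of the response -/
  y : Bool → G.Expo n (G.gen n ρ)

variable (G n) in
/-- All random choices are independent and uniform. -/
noncomputable def Coins.dist : PMF (Coins G n) :=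
  (PMF.uniformOfFintype (Bits (G.coinLen n))).bind fun ρ =>
  (PMF.uniformOfFintype (G.Expo n (G.gen n ρ))).bind fun a =>
  (PMF.uniformOfFintype Bool).bind fun b =>
  (PMF.uniformOfFintype (G.Expo n (G.gen n ρ))).bind fun r₁ =>
  (PMF.uniformOfFintype (G.Expo n (G.gen n ρ))).bind fun r₂ =>
  (PMF.uniformOfFintype (G.Expo n (G.gen n ρ))).bind fun y₀ =>
  (PMF.uniformOfFintype (G.Expo n (G.gen n ρ))).bind fun y₁ =>
    PMF.pure ⟨ρ, a, b, r₁, r₂, fun i => if i then y₁ else y₀⟩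

namespace Coins

variable (c : Coins G n) (H : Hash k) (m : Messages k) (s : Bool)

/-- The description of the group. -/
abbrev desc : Bits (G.descLen n) := G.gen n c.ρ

/-- The public element `C`. -/
def C : G.Elt n c.desc := expo (G.g n c.desc) c.a

/-- The public key `(C, p, g)`, with the description of the group. -/
def pkBits : List Bool := G.paramBits n c.desc ++ eltBits c.C

def s₁ : Bool := (share s c.b).1

def s₂ : Bool := (share s c.b).2

/-- The message from `P₂` to `P₁`. -/
def δ : Bool → G.Elt n c.desc := queryP₂ c.C (c.s₂ s) c.r₂

/-- The message from `P₁` to `S`. -/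
def β : Bool → G.Elt n c.desc := queryP₁ (c.δ s) (c.s₁ s) c.r₁

/-- The message from `S` to `R`. -/
noncomputable def res : Option (Bool → G.Elt n c.desc × Bits k) :=
  respond H c.C (c.β s) m c.y

/-- The output of `R`. -/
noncomputable def output : Option (Bits k) :=
  (c.res H m s).map fun e => retrieve H e (c.s₁ s) (c.s₂ s) c.r₁ c.r₂

/-- The view of each party: its input, its coins, the public key, the messages that it receives,
and, for `R`, its output. -/
noncomputable def view : Party → List Bool
  | .S => List.ofFn (m false) ++ List.ofFn (m true) ++
      List.ofFn c.ρ ++ expoBits c.a ++ expoBits (c.y false) ++ expoBits (c.y true) ++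
      c.pkBits ++ eltBits (c.β s false) ++ eltBits (c.β s true)
  | .P₁ => c.pkBits ++ [c.s₁ s] ++ expoBits c.r₁ ++ eltBits (c.δ s false) ++ eltBits (c.δ s true)
  | .P₂ => c.pkBits ++ [c.s₂ s] ++ expoBits c.r₂
  | .R => [s] ++ [c.b] ++ expoBits c.r₁ ++ expoBits c.r₂ ++ c.pkBits ++
      (match c.res H m s with
        | none => []
        | some e => eltBits (e false).1 ++ List.ofFn (e false).2 ++
            eltBits (e true).1 ++ List.ofFn (e true).2) ++
      (match c.output H m s with
        | none => []
        | some v => List.ofFn v)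

end Coins

end Protocol

/-- The views in an execution of the protocol with the group generator `G` and `σ n`-bit
messages. -/
noncomputable def view (G : GroupGen) (σ : ℕ → ℕ) (n : ℕ) (P : Party) (m : Messages (σ n))
    (s : Bool) (H : Hash (σ n)) : PMF (List Bool) :=
  (Coins.dist G n).map fun c => c.view H m s P

/-- In every execution, whatever the hash function and the random choices, `R` outputs `m_s`. -/
def Correct (G : GroupGen) (σ : ℕ → ℕ) : Prop :=
  ∀ n (H : Hash (σ n)) (m : Messages (σ n)) (s : Bool) (c : Coins G n),
    c.output H m s = some (m s)

end DQOT

/-!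
Correctness is the identity `β_s = g ^ x` for the secret exponent `x = r₂ + r₁ (-1) ^ s₂` of the
receiver (`Coins.β_self`), from which `β_{1-s} = C / g ^ x` and `β₀ β₁ = C` follow.

The sender and the proxies are simulated perfectly. In the view of `P₂` the share `s₂` is a uniform
bit. In the views of `P₁` and `S` the two group elements received are a uniform element and its
cofactor in `C`, because their exponents arise from a uniform exponent by the bijections
`r ↦ r + c` and `r ↦ a - r`.

The receiver cannot open the half `(g ^ y', H (β_{1-s} ^ y') ⊕ m_{1-s})` of the response. Put
`A = C / g ^ x = g ^ a'`. Then `(A, g ^ y')` is a Diffie–Hellman instance that is independent of all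
other coins, the mask is `H (g ^ (a' y'))`, and the rest of the view can be computed from the
instance (`view_R_eq`, `recvC_run`). The simulator draws the instance and replaces the masked
message by a random string. To compare both games, the oracle in the real one is reprogrammed at the
solution `T = g ^ (a' y')` by a fresh value (`lintegral_randomOracle_update`). The games then agree
until `T` is queried (`runGates_le_add_queryProb`), and the probability of that is at most the sum,
over the gates of the game, of the probability that the gate queries `T` (`queryProb_eq_sum`). Each
summand is the success probability of a circuit against CDH (`attackC`), which plays the game with a
lazily sampled oracle up to that gate and outputs the query (`lazyC_run`). Circuits are non-uniform,
so for every security parameter the best inputs and the best gate can be hard-wired (`exists_best`),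
and the advantage is at most a polynomial times one negligible CDH advantage.

Apart from the lazily sampled oracle, circuits are composed without reference to registers. A straight-line program
(`Prog`) calls circuits on blocks of bits; it compiles to a circuit with the expected output
distribution (`Prog.circuit_run`) and size (`Prog.circuit_size_le`). The size of a gate does not
depend on the register numbers in it, so every call gets a fresh region of registers.
-/

namespace DQOT

/-! ### Memory and relocation of gates -/

theorem Memory.write_of_notMem {r : ℕ} {dst : List ℕ} (h : r ∉ dst) (M : Memory) (w : List Bool) :
    M.write dst w r = M r := by
  induction dst generalizing M w with
  | nil => rfl
  | cons d ds ih =>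
    cases w with
    | nil => rfl
    | cons b w =>
      simp only [List.mem_cons, not_or] at h
      exact (ih h.2 (Function.update M d b) w).trans (Function.update_of_ne h.1 _ _)

theorem Memory.write_congr {r : ℕ} {M N : Memory} (h : M r = N r) (dst : List ℕ) (w : List Bool) :
    M.write dst w r = N.write dst w r := by
  induction dst generalizing M N w with
  | nil => exact h
  | cons d ds ih =>
    cases w with
    | nil => exact h
    | cons b w =>
      refine ih (M := Function.update M d b) (N := Function.update N d b) ?_ w
      by_cases hr : r = d
      · subst hr; simp
      · simpa [Function.update_of_ne hr] using h

theorem Memory.map_write {dst : List ℕ} (hd : dst.Nodup) (M : Memory) {w : List Bool}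
    (hw : w.length = dst.length) : dst.map (M.write dst w) = w := by
  induction dst generalizing M w with
  | nil => simpa [eq_comm] using hw
  | cons d ds ih =>
    cases w with
    | nil => simp at hw
    | cons b w =>
      rw [List.nodup_cons] at hd
      have h1 : M.write (d :: ds) (b :: w) = Memory.write (Function.update M d b) ds w := rfl
      rw [List.map_cons, h1, ih hd.2 _ (by simpa using hw), Memory.write_of_notMem hd.1]
      simp

theorem Memory.range_map_load (w : List Bool) : (List.range w.length).map (Memory.load w) = w := by
  apply List.ext_getElem <;> simp +contextual [Memory.load]

/-- The registers that a gate mentions. -/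
def Gate.regs : Gate → List ℕ
  | .const r _ => [r]
  | .nand r a b => [r, a, b]
  | .sample dst src => dst ++ src
  | .query dst src => dst ++ src

/-- Relocate a gate by `t` registers. -/
def Gate.shift (t : ℕ) : Gate → Gate
  | .const r b => .const (t + r) b
  | .nand r a b => .nand (t + r) (t + a) (t + b)
  | .sample dst src => .sample (dst.map (t + ·)) (src.map (t + ·))
  | .query dst src => .query (dst.map (t + ·)) (src.map (t + ·))

theorem Gate.size_shift (t : ℕ) (e : Gate) : (e.shift t).size = e.size := by
  cases e <;> simp [Gate.shift, Gate.size]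

/-- The memory `M`, with the registers `t, …, t + b - 1` replaced by the first `b` registers
of `N`. -/
def patch (t b : ℕ) (M N : Memory) : Memory := fun r =>
  if t ≤ r ∧ r < t + b then N (r - t) else M r

theorem patch_add {t b r : ℕ} (h : r < b) (M N : Memory) : patch t b M N (t + r) = N r := by
  simp [patch, h]

theorem patch_of_lt {t b r : ℕ} (h : r < t) (M N : Memory) : patch t b M N r = M r := by
  simp [patch, h]

theorem patch_of_ge {t b r : ℕ} (h : t + b ≤ r) (M N : Memory) : patch t b M N r = M r := by
  simp [patch, h]

theorem update_patch {t b r : ℕ} (h : r < b) (M N : Memory) (v : Bool) :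
    Function.update (patch t b M N) (t + r) v = patch t b M (Function.update N r v) := by
  funext q
  by_cases hq : q = t + r
  · subst hq; simp [patch, h]
  · rw [Function.update_of_ne hq]
    simp only [patch]
    split_ifs with h1
    · rw [Function.update_of_ne (by omega)]
    · rfl

theorem write_patch {t b : ℕ} {dst : List ℕ} (h : ∀ r ∈ dst, r < b) (M N : Memory)
    (w : List Bool) :
    (patch t b M N).write (dst.map (t + ·)) w = patch t b M (N.write dst w) := by
  induction dst generalizing N w with
  | nil => rfl
  | cons d ds ih =>
    cases w with
    | nil => rfl
    | cons v w =>
      simp only [List.mem_cons, forall_eq_or_imp] at h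
      have := ih h.2 (Function.update N d v) w
      rw [← update_patch h.1] at this
      exact this

theorem map_patch {t b : ℕ} {src : List ℕ} (h : ∀ r ∈ src, r < b) (M N : Memory) :
    (src.map (t + ·)).map (patch t b M N) = src.map N := by
  rw [List.map_map]
  exact List.map_congr_left fun r hr => patch_add (h r hr) M N

theorem Gate.step_shift (O : Oracle) {t b : ℕ} (M N : Memory) (e : Gate)
    (h : ∀ r ∈ e.regs, r < b) :
    (e.shift t).step O (patch t b M N) = (e.step O N).map (patch t b M) := by
  cases e with
  | const r v =>
    simp only [Gate.regs, List.mem_singleton, forall_eq] at h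
    simp [Gate.shift, Gate.step, PMF.pure_map, update_patch h]
  | nand r x y =>
    simp only [Gate.regs, List.mem_cons, forall_eq_or_imp, List.not_mem_nil, false_implies,
      implies_true, and_true] at h
    simp [Gate.shift, Gate.step, PMF.pure_map, update_patch h.1, patch_add h.2.1, patch_add h.2.2]
  | sample dst src =>
    simp only [Gate.regs, List.mem_append] at h
    simp only [Gate.shift, Gate.step, PMF.map_comp, map_patch fun r hr => h r (.inr hr)]
    congr 1
    funext x
    simp [write_patch fun r hr => h r (.inl hr)]
  | query dst src =>
    simp only [Gate.regs, List.mem_append] at h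
    simp only [Gate.shift, Gate.step, PMF.pure_map, map_patch fun r hr => h r (.inr hr),
      write_patch fun r hr => h r (.inl hr)]

/-- Relocated gates act on the region `t, …, t + b - 1` as the original gates act on the registers
`0, …, b - 1`, and leave all other registers unchanged. -/
theorem runGates_shift (O : Oracle) {t b : ℕ} (M N : Memory) (es : List Gate)
    (h : ∀ e ∈ es, ∀ r ∈ e.regs, r < b) :
    runGates O (es.map (Gate.shift t)) (patch t b M N) = (runGates O es N).map (patch t b M) := by
  induction es generalizing N with
  | nil => simp [runGates, PMF.pure_map]
  | cons e es ih =>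
    simp only [List.mem_cons, forall_eq_or_imp] at h
    simp only [List.map_cons, runGates, Gate.step_shift O M N e h.1, PMF.bind_map, PMF.map_bind]
    congr 1
    funext N'
    exact ih N' h.2

theorem runGates_append (O : Oracle) (es fs : List Gate) (M : Memory) :
    runGates O (es ++ fs) M = (runGates O es M).bind (runGates O fs) := by
  induction es generalizing M with
  | nil => simp [runGates]
  | cons e es ih =>
    simp only [List.cons_append, runGates, PMF.bind_bind]
    congr 1
    funext M'
    exact ih M'

/-- A bound for the registers that a list of gates mentions. -/
def regsBound (es : List Gate) : ℕ := (es.flatMap Gate.regs).sum + 1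

theorem lt_regsBound {es : List Gate} {e : Gate} (he : e ∈ es) {r : ℕ} (hr : r ∈ e.regs) :
    r < regsBound es :=
  Nat.lt_succ_of_le (List.le_sum_of_mem (List.mem_flatMap.2 ⟨e, he, hr⟩))

/-- The total size of a list of gates. -/
def gatesSize (es : List Gate) : ℕ := (es.map Gate.size).sum

@[simp] theorem gatesSize_nil : gatesSize [] = 0 := rfl

@[simp] theorem gatesSize_cons (e : Gate) (es : List Gate) :
    gatesSize (e :: es) = e.size + gatesSize es := by simp [gatesSize]

@[simp] theorem gatesSize_append (es fs : List Gate) :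
    gatesSize (es ++ fs) = gatesSize es + gatesSize fs := by simp [gatesSize]

theorem gatesSize_shift (t : ℕ) (es : List Gate) :
    gatesSize (es.map (Gate.shift t)) = gatesSize es := by
  induction es with
  | nil => rfl
  | cons e es ih => simp [ih, Gate.size_shift]

/-- Gates that copy the registers `src` to the registers `dst`, each bit by a double negation. -/
def copyGates : List ℕ → List ℕ → List Gate
  | d :: ds, s :: ss => .nand d s s :: .nand d d d :: copyGates ds ss
  | _, _ => []

theorem runGates_copyGates (O : Oracle) (dst src : List ℕ) (h : ∀ r ∈ src, r ∉ dst) (M : Memory) :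
    runGates O (copyGates dst src) M = PMF.pure (M.write dst (src.map M)) := by
  induction dst generalizing src M with
  | nil => simp [copyGates, runGates, Memory.write]
  | cons d ds ih =>
    cases src with
    | nil => simp [copyGates, runGates, Memory.write]
    | cons s ss =>
      simp only [List.mem_cons, forall_eq_or_imp, not_or] at h
      have h1 : ss.map (Function.update M d (M s)) = ss.map M :=
        List.map_congr_left fun r hr => Function.update_of_ne (h.2 r hr).1 _ _
      simp only [copyGates, runGates, Gate.step, PMF.pure_bind, Function.update_self,
        Bool.and_self, Bool.not_not, Function.update_idem]
      rw [ih ss (fun r hr => (h.2 r hr).2), h1]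
      rfl

theorem gatesSize_copyGates (dst src : List ℕ) : gatesSize (copyGates dst src) ≤ 8 * src.length := by
  induction dst generalizing src with
  | nil => simp [copyGates]
  | cons d ds ih =>
    cases src with
    | nil => simp [copyGates]
    | cons s ss =>
      have := ih ss
      simp only [copyGates, gatesSize_cons, Gate.size, List.length_cons]
      omega

theorem Circuit.size_eq (A : Circuit) : A.size = A.outLen + gatesSize A.gates := rfl

/-! ### Straight-line composition of circuits -/

/-- Concatenate the blocks of `env` whose positions are listed in `src`. -/
def gather {α : Type*} (env : List (List α)) (src : List ℕ) : List α :=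
  src.flatMap fun i => env.getD i []

theorem gather_map {α β : Type*} (f : α → β) (env : List (List α)) (src : List ℕ) :
    (gather env src).map f = gather (env.map (List.map f)) src := by
  simp only [gather, List.map_flatMap]
  congr 1
  funext i
  by_cases h : i < env.length <;> simp [h]

theorem mem_gather {α : Type*} {env : List (List α)} {src : List ℕ} {x : α}
    (h : x ∈ gather env src) : ∃ l ∈ env, x ∈ l := by
  obtain ⟨i, -, hi⟩ := List.mem_flatMap.1 h
  by_cases hlt : i < env.length
  · exact ⟨env[i], List.getElem_mem _, by simpa [hlt] using hi⟩
  · simp [hlt] at hi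

theorem length_gather_le {α : Type*} (env : List (List α)) (src : List ℕ) :
    (gather env src).length ≤ src.length * (env.map List.length).sum := by
  induction src with
  | nil => simp [gather]
  | cons i src ih =>
    have h : (env.getD i []).length ≤ (env.map List.length).sum := by
      by_cases hlt : i < env.length
      · have : env[i].length ∈ env.map List.length :=
          List.mem_map.2 ⟨_, List.getElem_mem hlt, rfl⟩
        simpa [hlt] using List.le_sum_of_mem this
      · simp [hlt]
    have h2 : gather env (i :: src) = env.getD i [] ++ gather env src := by simp [gather]
    rw [h2, List.length_append, List.length_cons, Nat.add_mul, one_mul]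
    omega

/-- A straight-line program. Its state is a list of blocks of bits; the instruction `(src, A)` runs
the circuit `A` on the concatenation of the blocks at the positions `src`, and appends the output as
a new block. -/
abbrev Prog := List (List ℕ × Circuit)

/-- The distribution of the blocks after the execution of a program. -/
noncomputable def Prog.eval (O : Oracle) : Prog → List (List Bool) → PMF (List (List Bool))
  | [], env => PMF.pure env
  | (src, A) :: P, env => (A.run O (gather env src)).bind fun o => Prog.eval O P (env ++ [o])

/-- A number of registers that suffices to run `A` on inputs of length `ℓ`. -/
def Circuit.width (A : Circuit) (ℓ : ℕ) : ℕ := regsBound A.gates + A.outLen + ℓ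

/-- Compile a program into gates. The blocks of the state are held in the registers listed in
`locs`; all registers from `t` on are unused. The result lists the gates, the first register unused
after their execution, and the final position of the blocks. -/
def Prog.code : Prog → ℕ → List (List ℕ) → List Gate × ℕ × List (List ℕ)
  | [], t, locs => ([], t, locs)
  | (src, A) :: P, t, locs =>
    let inp := gather locs src
    let rest := Prog.code P (t + A.width inp.length) (locs ++ [List.range' t A.outLen])
    (copyGates (List.range' t inp.length) inp ++ A.gates.map (Gate.shift t) ++ rest.1, rest.2)

/-- The circuit that runs a program on the single initial block of length `ℓ` and outputs the
concatenation of the blocks at the positions `out`. The output is first copied to unused registers,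
as the registers `0, 1, …` to which it has to go may hold parts of it. -/
def Prog.circuit (P : Prog) (ℓ : ℕ) (out : List ℕ) : Circuit :=
  let c := P.code ℓ [List.range ℓ]
  let o := gather c.2.2 out
  { gates := c.1 ++ (copyGates (List.range' (c.2.1 + o.length) o.length) o ++
      copyGates (List.range o.length) (List.range' (c.2.1 + o.length) o.length))
    outLen := o.length }

theorem Prog.code_locs_lt (P : Prog) (t : ℕ) (locs : List (List ℕ))
    (h : ∀ l ∈ locs, ∀ r ∈ l, r < t) :
    ∀ l ∈ (P.code t locs).2.2, ∀ r ∈ l, r < (P.code t locs).2.1 := by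
  induction P generalizing t locs with
  | nil => exact h
  | cons e P ih =>
    obtain ⟨src, A⟩ := e
    refine ih _ _ fun l hl r hr => ?_
    rcases List.mem_append.1 hl with hl | hl
    · exact (h l hl r hr).trans_le (Nat.le_add_right _ _)
    · rw [List.mem_singleton.1 hl, List.mem_range'_1] at hr
      simp only [Circuit.width]
      omega

/-- The gates copied and relocated for one instruction act as the circuit of that instruction. -/
theorem runGates_call (O : Oracle) (A : Circuit) (t : ℕ) (inp : List ℕ) (M : Memory)
    (h0 : ∀ r, t ≤ r → M r = false) (hi : ∀ r ∈ inp, r < t) :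
    runGates O (copyGates (List.range' t inp.length) inp ++ A.gates.map (Gate.shift t)) M =
      (runGates O A.gates (Memory.load (inp.map M))).map (patch t (A.width inp.length) M) := by
  have hcopy : M.write (List.range' t inp.length) (inp.map M) =
      patch t (A.width inp.length) M (Memory.load (inp.map M)) := by
    funext r
    by_cases hr : r ∈ List.range' t inp.length
    · rw [List.mem_range'_1] at hr
      have h1 := Memory.map_write (List.nodup_range' (s := t) (n := inp.length)) M
        (w := inp.map M) (by simp)
      have h2 := congrArg (fun l => l[r - t]?) h1
      have h3 : r - t < inp.length := by omega
      have h4 : t + (r - t) = r := by omega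
      simp only [List.getElem?_map, List.getElem?_range' h3, h3, List.getElem?_eq_getElem,
        Option.map_some, one_mul, h4, Option.some.injEq] at h2
      rw [h2, patch, if_pos ⟨hr.1, by simp only [Circuit.width]; omega⟩]
      simp [Memory.load, h3]
    · rw [Memory.write_of_notMem hr, patch]
      rw [List.mem_range'_1] at hr
      split_ifs with h
      · rw [h0 r h.1, Memory.load, List.getD_eq_default]
        simp only [List.length_map]
        omega
      · rfl
  rw [runGates_append, runGates_copyGates O _ _ (fun r hr hr' => by
    have := hi r hr; rw [List.mem_range'_1] at hr'; omega), PMF.pure_bind, hcopy,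
    runGates_shift]
  intro e he r hr
  have := lt_regsBound he hr
  simp only [Circuit.width]
  omega

/-- Compilation is correct. All registers from `t` on have to be `false`, because a circuit may read
registers beyond its input and relies on their initial value. -/
theorem Prog.runGates_code (O : Oracle) (P : Prog) (t : ℕ) (locs : List (List ℕ)) (M : Memory)
    (h0 : ∀ r, t ≤ r → M r = false) (h : ∀ l ∈ locs, ∀ r ∈ l, r < t) :
    (runGates O (P.code t locs).1 M).map (fun M' => (P.code t locs).2.2.map (List.map M')) =
      P.eval O (locs.map (List.map M)) := by
  induction P generalizing t locs M with
  | nil => simp [Prog.code, Prog.eval, runGates, PMF.pure_map]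
  | cons e P ih =>
    obtain ⟨src, A⟩ := e
    have hi : ∀ r ∈ gather locs src, r < t := fun r hr => by
      obtain ⟨l, hl, hr⟩ := mem_gather hr
      exact h l hl r hr
    have hl' : ∀ l ∈ locs ++ [List.range' t A.outLen], ∀ r ∈ l,
        r < t + A.width (gather locs src).length := by
      intro l hl r hr
      rcases List.mem_append.1 hl with hl | hl
      · exact (h l hl r hr).trans_le (Nat.le_add_right _ _)
      · rw [List.mem_singleton.1 hl, List.mem_range'_1] at hr
        simp only [Circuit.width]
        omega
    simp only [Prog.code, Prog.eval, Circuit.run]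
    rw [runGates_append, runGates_call O A t _ M h0 hi, PMF.bind_map, PMF.bind_map, PMF.map_bind,
      ← gather_map]
    congr 1
    funext N
    simp only [Function.comp_apply]
    rw [ih _ _ _ (fun r hr => by rw [patch_of_ge hr, h0 r (by omega)]) hl']
    congr 1
    simp only [List.map_append, List.map_cons, List.map_nil]
    congr 1
    · refine List.map_congr_left fun l hl => List.map_congr_left fun r hr => ?_
      exact patch_of_lt (h l hl r hr) _ _
    · congr 1
      rw [List.range'_eq_map_range, List.map_map]
      refine List.map_congr_left fun r hr => ?_
      rw [List.mem_range] at hr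
      exact patch_add (by simp only [Circuit.width]; omega) _ _

theorem Prog.circuit_run (O : Oracle) (P : Prog) (out : List ℕ) (w : List Bool) {ℓ : ℕ}
    (hw : w.length = ℓ) :
    (P.circuit ℓ out).run O w = (P.eval O [w]).map fun env => gather env out := by
  subst hw
  have hl : ∀ l ∈ [List.range w.length], ∀ r ∈ l, r < w.length := by simp
  have key := Prog.runGates_code O P w.length [List.range w.length] (Memory.load w)
    (fun r hr => by simp [Memory.load, hr]) hl
  simp only [List.map_cons, List.map_nil, Memory.range_map_load] at key
  have hlt := Prog.code_locs_lt P w.length [List.range w.length] hl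
  simp only [Prog.circuit, Circuit.run]
  set c := P.code w.length [List.range w.length] with hc
  set o := gather c.2.2 out with ho
  have ho' : ∀ r ∈ o, r < c.2.1 := fun r hr => by
    obtain ⟨l, hl, hr⟩ := mem_gather hr
    exact hlt l hl r hr
  rw [← key, runGates_append, PMF.map_comp, PMF.map_bind, ← PMF.bind_pure_comp]
  congr 1
  funext M
  rw [runGates_append, runGates_copyGates O _ _ (fun r hr hr' => by
    have := ho' r hr; rw [List.mem_range'_1] at hr'; omega), PMF.pure_bind,
    runGates_copyGates O _ _ (fun r hr hr' => by
      rw [List.mem_range'_1] at hr; rw [List.mem_range] at hr'; omega), PMF.pure_map]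
  rw [Memory.map_write List.nodup_range' _ (by simp), Memory.map_write List.nodup_range _ (by simp)]
  simp only [Function.comp_apply, ← gather_map, ← ho]

theorem Prog.gatesSize_code_le (P : Prog) (t : ℕ) (locs : List (List ℕ)) (B : ℕ)
    (hB : (locs.map List.length).sum + (P.map fun e => e.2.outLen).sum ≤ B) :
    gatesSize (P.code t locs).1 ≤
        (P.map fun e => e.2.size).sum + 8 * ((P.map fun e => e.1.length).sum * B) ∧
      ((P.code t locs).2.2.map List.length).sum ≤ B := by
  induction P generalizing t locs with
  | nil => simpa [Prog.code] using hB
  | cons e P ih =>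
    obtain ⟨src, A⟩ := e
    simp only [List.map_cons, List.sum_cons] at hB
    have h1 := ih (t + A.width (gather locs src).length) (locs ++ [List.range' t A.outLen])
      (by simp; omega)
    have h2 := gatesSize_copyGates (List.range' t (gather locs src).length) (gather locs src)
    have h3 := length_gather_le locs src
    have h4 : src.length * (locs.map List.length).sum ≤ src.length * B :=
      Nat.mul_le_mul_left _ (by omega)
    simp only [Prog.code, gatesSize_append, gatesSize_shift, List.map_cons, List.sum_cons,
      Circuit.size_eq, Nat.add_mul] at h1 ⊢
    refine ⟨?_, h1.2⟩
    omega

/-- The size of a compiled program: the sizes of the circuits that it calls, and the cost of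
copying. -/
theorem Prog.circuit_size_le (P : Prog) (ℓ : ℕ) (out : List ℕ) :
    (P.circuit ℓ out).size ≤ (P.map fun e => e.2.size).sum +
      17 * (((P.map fun e => e.1.length).sum + out.length) *
        (ℓ + (P.map fun e => e.2.outLen).sum)) := by
  obtain ⟨h1, h2⟩ := P.gatesSize_code_le ℓ [List.range ℓ] _ (by simp; exact le_rfl)
  rw [Circuit.size_eq]
  simp only [Prog.circuit, gatesSize_append]
  set c := P.code ℓ [List.range ℓ]
  set B := ℓ + (P.map fun e => e.2.outLen).sum
  set o := gather c.2.2 out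
  have h3 : o.length ≤ out.length * B :=
    (length_gather_le _ _).trans (Nat.mul_le_mul_left _ h2)
  have h4 := gatesSize_copyGates (List.range' (c.2.1 + o.length) o.length) o
  have h5 := gatesSize_copyGates (List.range o.length) (List.range' (c.2.1 + o.length) o.length)
  simp only [List.length_range', Nat.add_mul] at h5 ⊢
  omega

/-! ### Boolean formulas as circuits -/

/-- Boolean formulas over the registers. -/
inductive BExp where
  | var (i : ℕ)
  | const (b : Bool)
  | nand (x y : BExp)

namespace BExp

/-- The value of a formula. -/
def eval (v : ℕ → Bool) : BExp → Bool
  | var i => v i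
  | const b => b
  | nand x y => !(x.eval v && y.eval v)

/-- A bound for the registers that occur in a formula. -/
def bound : BExp → ℕ
  | var i => i + 1
  | const _ => 0
  | nand x y => max x.bound y.bound

/-- The size of the gates that evaluate a formula. -/
def cost : BExp → ℕ
  | var _ => 8
  | const _ => 2
  | nand x y => x.cost + y.cost + 4

/-- Gates that write the value of a formula to register `t`, with scratch space above `t`. -/
def gates : BExp → ℕ → List Gate
  | var i, t => [.nand t i i, .nand t t t]
  | const b, t => [.const t b]
  | nand x y, t => x.gates t ++ y.gates (t + 1) ++ [.nand t t (t + 1)]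

theorem eval_congr {v w : ℕ → Bool} (e : BExp) (h : ∀ r < e.bound, v r = w r) :
    e.eval v = e.eval w := by
  induction e with
  | var i => exact h i (Nat.lt_succ_self i)
  | const b => rfl
  | nand x y hx hy =>
    simp only [eval, hx fun r hr => h r (lt_max_of_lt_left hr),
      hy fun r hr => h r (lt_max_of_lt_right hr)]

theorem gatesSize_gates (e : BExp) (t : ℕ) : gatesSize (e.gates t) = e.cost := by
  induction e generalizing t with
  | var i => rfl
  | const b => rfl
  | nand x y hx hy => simp [gates, hx, hy, cost, Gate.size, add_assoc]

theorem runGates_gates (O : Oracle) (e : BExp) (t : ℕ) (M : Memory) (h : e.bound ≤ t) :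
    ∃ M', runGates O (e.gates t) M = PMF.pure M' ∧ M' t = e.eval M ∧ ∀ r < t, M' r = M r := by
  induction e generalizing t M with
  | var i =>
    have hi : i < t := h
    refine ⟨Function.update M t (M i), ?_, by simp [eval], fun r hr => ?_⟩
    · simp [gates, runGates, Gate.step]
    · exact Function.update_of_ne hr.ne _ _
  | const b =>
    refine ⟨Function.update M t b, ?_, by simp [eval], fun r hr => ?_⟩
    · simp [gates, runGates, Gate.step]
    · exact Function.update_of_ne hr.ne _ _
  | nand x y hx hy =>
    have hxb : x.bound ≤ t := (le_max_left _ _).trans h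
    have hyb : y.bound ≤ t := (le_max_right _ _).trans h
    obtain ⟨M1, h1, h1t, h1r⟩ := hx t M hxb
    obtain ⟨M2, h2, h2t, h2r⟩ := hy (t + 1) M1 (by omega)
    refine ⟨Function.update M2 t (!(M2 t && M2 (t + 1))), ?_, ?_, fun r hr => ?_⟩
    · simp only [gates, runGates_append, h1, h2, PMF.pure_bind, runGates, Gate.step]
    · rw [Function.update_self, h2t, h2r t (by omega), h1t,
        y.eval_congr (w := M) fun r hr => h1r r (by omega)]
      rfl
    · rw [Function.update_of_ne hr.ne, h2r r (by omega), h1r r hr]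

/-- Negation. -/
def not (x : BExp) : BExp := nand x (const true)

/-- Conjunction. -/
def and (x y : BExp) : BExp := (nand x y).not

/-- Exclusive or. -/
def xor (x y : BExp) : BExp := (nand x y).and (nand x.not y.not)

/-- `if c then x else y`. -/
def mux (c x y : BExp) : BExp := nand (nand c x) (nand c.not y)

@[simp] theorem eval_not (v : ℕ → Bool) (x : BExp) : x.not.eval v = !x.eval v := by
  simp [not, eval]

@[simp] theorem eval_and (v : ℕ → Bool) (x y : BExp) :
    (x.and y).eval v = (x.eval v && y.eval v) := by simp [and, eval]

@[simp] theorem eval_xor (v : ℕ → Bool) (x y : BExp) :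
    (x.xor y).eval v = Bool.xor (x.eval v) (y.eval v) := by
  simp only [xor, eval_and, eval, eval_not]
  cases x.eval v <;> cases y.eval v <;> rfl

@[simp] theorem eval_mux (v : ℕ → Bool) (c x y : BExp) :
    (c.mux x y).eval v = if c.eval v then x.eval v else y.eval v := by
  simp only [mux, eval, eval_not]
  cases c.eval v <;> simp

end BExp

/-- Gates that evaluate a list of formulas into the registers from `t` on. -/
def formGates : List BExp → ℕ → List Gate
  | [], _ => []
  | e :: es, t => e.gates t ++ formGates es (t + 1)

theorem gatesSize_formGates (es : List BExp) (t : ℕ) :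
    gatesSize (formGates es t) = (es.map BExp.cost).sum := by
  induction es generalizing t with
  | nil => rfl
  | cons e es ih => simp [formGates, ih, BExp.gatesSize_gates]

theorem runGates_formGates (O : Oracle) (es : List BExp) (t : ℕ) (M : Memory)
    (h : ∀ e ∈ es, e.bound ≤ t) :
    ∃ M', runGates O (formGates es t) M = PMF.pure M' ∧
      (List.range' t es.length).map M' = es.map (BExp.eval M) ∧ ∀ r < t, M' r = M r := by
  induction es generalizing t M with
  | nil => exact ⟨M, rfl, rfl, fun _ _ => rfl⟩
  | cons e es ih =>
    simp only [List.mem_cons, forall_eq_or_imp] at h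
    obtain ⟨M1, h1, h1t, h1r⟩ := e.runGates_gates O t M h.1
    obtain ⟨M2, h2, h2t, h2r⟩ := ih (t + 1) M1 fun f hf => (h.2 f hf).trans (Nat.le_succ t)
    refine ⟨M2, by simp [formGates, runGates_append, h1, h2], ?_, fun r hr => ?_⟩
    · simp only [List.length_cons, List.range'_succ, List.map_cons, h2r t (Nat.lt_succ_self t), h1t,
        h2t]
      congr 1
      exact List.map_congr_left fun f hf => f.eval_congr fun r hr =>
        h1r r (hr.trans_le (h.2 f hf))
    · rw [h2r r (by omega), h1r r hr]

/-- The circuit whose output bits are given by formulas in the input bits. -/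
def formC (es : List BExp) : Circuit :=
  let t := (es.map BExp.bound).sum + es.length
  -- the values are computed beyond the input and then moved to the output registers
  { gates := formGates es t ++ copyGates (List.range es.length) (List.range' t es.length)
    outLen := es.length }

theorem formC_run (O : Oracle) (es : List BExp) (w : List Bool) :
    (formC es).run O w = PMF.pure (es.map (BExp.eval (Memory.load w))) := by
  obtain ⟨M, h1, h2, -⟩ := runGates_formGates O es ((es.map BExp.bound).sum + es.length)
    (Memory.load w) fun e he =>
      (List.le_sum_of_mem (List.mem_map_of_mem he)).trans (Nat.le_add_right _ _)
  simp only [formC, Circuit.run, runGates_append, h1, PMF.pure_bind]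
  rw [runGates_copyGates O _ _ (fun r hr hr' => by
    rw [List.mem_range'_1] at hr; rw [List.mem_range] at hr'; omega), PMF.pure_map,
    Memory.map_write List.nodup_range _ (by simp), h2]

theorem formC_size_le (es : List BExp) (c : ℕ) (h : ∀ e ∈ es, e.cost ≤ c) :
    (formC es).size ≤ (c + 9) * es.length := by
  have h1 : (es.map BExp.cost).sum ≤ es.length * c := by
    simpa using List.sum_le_card_nsmul (es.map BExp.cost) c (by simpa using h)
  have h2 := gatesSize_copyGates (List.range es.length)
    (List.range' ((es.map BExp.bound).sum + es.length) es.length)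
  rw [Circuit.size_eq]
  simp only [formC, gatesSize_append, gatesSize_formGates, List.length_range'] at h2 ⊢
  rw [Nat.add_mul, mul_comm c]
  omega

/-! ### Elementary circuits -/

/-- Extract `l` bits from position `s` on. -/
def sliceC (s l : ℕ) : Circuit := formC ((List.range l).map fun i => .var (s + i))

theorem sliceC_run (O : Oracle) {s l : ℕ} {w : List Bool} (a b c : List Bool)
    (h : w = a ++ b ++ c) (ha : a.length = s) (hb : b.length = l) :
    (sliceC s l).run O w = PMF.pure b := by
  subst h ha hb
  rw [sliceC, formC_run, List.map_map]
  congr 1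
  apply List.ext_getElem
  · simp
  · intro i h1 h2
    simp [BExp.eval, Memory.load, List.getElem?_append, h2]

theorem sliceC_size (s l : ℕ) : (sliceC s l).size ≤ 17 * l := by
  simpa [sliceC] using formC_size_le (c := 8) (es := (List.range l).map fun i => .var (s + i))
    (by simp [BExp.cost])

/-- Bitwise exclusive or of two `l`-bit strings. -/
def xorC (l : ℕ) : Circuit := formC ((List.range l).map fun i => (BExp.var i).xor (.var (l + i)))

theorem xorC_run (O : Oracle) {l : ℕ} (u v : Bits l) :
    (xorC l).run O (List.ofFn u ++ List.ofFn v) = PMF.pure (List.ofFn (bxor u v)) := by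
  rw [xorC, formC_run, List.map_map]
  congr 1
  apply List.ext_getElem
  · simp
  · intro i h1 h2
    have hi : i < l := by simpa using h1
    simp [BExp.eval, Memory.load, List.getElem?_append, hi, bxor]

theorem xorC_size (l : ℕ) : (xorC l).size ≤ 100 * l := by
  simpa [xorC] using (formC_size_le (c := 91) (es := (List.range l).map fun i => (BExp.var i).xor (.var (l + i)))
    (by simp [BExp.cost, BExp.xor, BExp.and, BExp.not]))

/-- `if c then a else b`, for a bit `c` and `l`-bit strings `a` and `b`. -/
def muxC (l : ℕ) : Circuit :=
  formC ((List.range l).map fun i => (BExp.var 0).mux (.var (1 + i)) (.var (1 + l + i)))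

theorem muxC_run (O : Oracle) {l : ℕ} (c : Bool) (a b : List Bool) (ha : a.length = l)
    (hb : b.length = l) :
    (muxC l).run O (c :: (a ++ b)) = PMF.pure (if c then a else b) := by
  rw [muxC, formC_run, List.map_map]
  congr 1
  apply List.ext_getElem
  · cases c <;> simp [ha, hb]
  · intro i h1 h2
    have hi : i < l := by simpa using h1
    have e1 : 1 + i = i + 1 := by omega
    have e2 : 1 + l + i = l + i + 1 := by omega
    cases c <;> simp [BExp.eval, Memory.load, List.getElem?_append, hi, e1, e2, ha, hb]

theorem muxC_size (l : ℕ) : (muxC l).size ≤ 100 * l := by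
  simpa [muxC] using (formC_size_le (c := 91) (es := (List.range l).map fun i =>
    (BExp.var 0).mux (.var (1 + i)) (.var (1 + l + i)))
    (by simp [BExp.cost, BExp.mux, BExp.not]))

/-- Output a fixed string. -/
def constC (w : List Bool) : Circuit := formC (w.map .const)

theorem constC_run (O : Oracle) (w v : List Bool) : (constC w).run O v = PMF.pure w := by
  rw [constC, formC_run, List.map_map]
  congr 1
  exact (List.map_congr_left fun b _ => rfl).trans (List.map_id w)

theorem constC_size (w : List Bool) : (constC w).size ≤ 11 * w.length := by
  simpa [constC] using formC_size_le (c := 2) (es := w.map .const) (fun e he => by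
    obtain ⟨b, -, rfl⟩ := List.mem_map.1 he
    exact le_rfl)

/-- Query the oracle on the whole input of length `ℓ`; the answer has `k` bits. -/
def queryC (ℓ k : ℕ) : Circuit := ⟨[.query (List.range k) (List.range ℓ)], k⟩

theorem queryC_run (O : Oracle) {ℓ k : ℕ} (w : List Bool) (hw : w.length = ℓ)
    (hO : (O w).length = k) : (queryC ℓ k).run O w = PMF.pure (O w) := by
  subst hw
  simp only [queryC, Circuit.run, runGates, Gate.step, PMF.pure_bind, PMF.pure_map,
    Memory.range_map_load]
  rw [Memory.map_write List.nodup_range _ (by simpa using hO)]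

theorem queryC_size (ℓ k : ℕ) : (queryC ℓ k).size ≤ 1 + 2 * k + ℓ := by
  simp only [queryC, Circuit.size_eq, gatesSize_cons, gatesSize_nil, Gate.size, List.length_range]
  omega

/-! ### Uniform sampling -/

/-- `uniformBelow N` is the law of `f` under the uniform distribution on `α`, for every bijection `f`
from `α` onto the numbers below `N`. -/
theorem uniformBelow_eq_map {α : Type*} [Fintype α] [Nonempty α] {N : ℕ} (f : α → ℕ)
    (hf : Function.Injective f) (hlt : ∀ a, f a < N) (hc : Fintype.card α = N) :
    uniformBelow N = (PMF.uniformOfFintype α).map f := by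
  classical
  have hN : max N 1 = N := by have := Fintype.card_pos (α := α); omega
  have himg : Finset.univ.image f = Finset.range N := by
    apply Finset.eq_of_subset_of_card_le
    · intro x hx
      obtain ⟨a, -, rfl⟩ := Finset.mem_image.1 hx
      exact Finset.mem_range.2 (hlt a)
    · rw [Finset.card_image_of_injective _ hf, Finset.card_univ, hc, Finset.card_range]
  ext x
  simp only [uniformBelow, PMF.uniformOfFinset_apply, PMF.map_apply, PMF.uniformOfFintype_apply, hN,
    hc, ← himg]
  split_ifs with h
  · obtain ⟨a, -, rfl⟩ := Finset.mem_image.1 h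
    rw [tsum_eq_single a fun b hb => if_neg fun h' => hb (hf h'.symm)]
    simp [himg]
  · symm
    rw [ENNReal.tsum_eq_zero]
    intro a
    exact if_neg fun h' => h (Finset.mem_image.2 ⟨a, Finset.mem_univ a, h'.symm⟩)

theorem uniformOfFintype_map_equiv {α β : Type*} [Fintype α] [Nonempty α] [Fintype β] [Nonempty β]
    (e : α ≃ β) : (PMF.uniformOfFintype α).map e = PMF.uniformOfFintype β := by
  ext x
  rw [PMF.map_apply, tsum_eq_single (e.symm x) fun b hb => if_neg fun h => hb (by simp [h])]
  simp [Fintype.card_congr e]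

theorem uniformOfFintype_bind_equiv {α : Type*} {γ : Type*} [Fintype α] [Nonempty α] (e : α ≃ α)
    (f : α → PMF γ) :
    ((PMF.uniformOfFintype α).bind fun x => f (e x)) = (PMF.uniformOfFintype α).bind f := by
  conv_rhs => rw [← uniformOfFintype_map_equiv e, PMF.bind_map]
  rfl

theorem natToBits_succ (k x : ℕ) : natToBits (k + 1) x = x.testBit 0 :: natToBits k (x / 2) := by
  simp [natToBits, List.ofFn_succ, Nat.testBit_succ]

@[simp] theorem length_natToBits (k x : ℕ) : (natToBits k x).length = k := by simp [natToBits]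

theorem bitsToNat_natToBits {k x : ℕ} (h : x < 2 ^ k) : bitsToNat (natToBits k x) = x := by
  induction k generalizing x with
  | zero => simp at h; subst h; rfl
  | succ k ih =>
    rw [natToBits_succ]
    have h1 := ih (x := x / 2) (by rw [pow_succ] at h; omega)
    simp only [bitsToNat, List.map_cons, Nat.ofDigits_cons] at h1 ⊢
    rw [h1, Nat.testBit_zero]
    rcases Nat.mod_two_eq_zero_or_one x with h2 | h2 <;> simp [h2] <;> omega

/-- The binary expansion of numbers below `2 ^ k`. -/
noncomputable def bitsEquiv (k : ℕ) : Fin (2 ^ k) ≃ Bits k :=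
  Equiv.ofBijective (fun x i => x.val.testBit i) <| by
    rw [Fintype.bijective_iff_injective_and_card]
    refine ⟨fun x y h => Fin.ext (Nat.eq_of_testBit_eq fun i => ?_), by simp⟩
    by_cases hi : i < k
    · exact congrFun h ⟨i, hi⟩
    · have h2 : 2 ^ k ≤ 2 ^ i := Nat.pow_le_pow_right (by norm_num) (by omega)
      rw [Nat.testBit_lt_two_pow (x.isLt.trans_le h2), Nat.testBit_lt_two_pow (y.isLt.trans_le h2)]

theorem uniformBelow_two_pow_map (k : ℕ) :
    (uniformBelow (2 ^ k)).map (natToBits k) = (PMF.uniformOfFintype (Bits k)).map List.ofFn := by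
  rw [uniformBelow_eq_map (N := 2 ^ k) (fun b : Bits k => ((bitsEquiv k).symm b).val)
    (Fin.val_injective.comp (bitsEquiv k).symm.injective) (fun b => Fin.isLt _) (by simp),
    PMF.map_comp]
  congr 1
  funext b
  have := (bitsEquiv k).apply_symm_apply b
  simp only [Function.comp_apply, natToBits]
  conv_rhs => rw [← this]
  rfl

/-- Gates that write uniformly random bits to the registers `dst`, with scratch registers `z` and
`z + 1`: they draw a uniform number below `2 ^ k` where `k` is the length of `dst`. -/
def coinGates (dst : List ℕ) (z : ℕ) : List Gate :=
  [.const z false, .const (z + 1) true,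
    .sample dst (List.replicate dst.length z ++ [z + 1])]

theorem runGates_coinGates (O : Oracle) (dst : List ℕ) (z : ℕ) (M : Memory) :
    ∃ M' : Memory, (∀ r, r ≠ z → r ≠ z + 1 → M' r = M r) ∧ runGates O (coinGates dst z) M =
      (PMF.uniformOfFintype (Bits dst.length)).map fun u => M'.write dst (List.ofFn u) := by
  refine ⟨Function.update (Function.update M z false) (z + 1) true, fun r h1 h2 => ?_, ?_⟩
  · rw [Function.update_of_ne h2, Function.update_of_ne h1]
  · have h : bitsToNat ((List.replicate dst.length z ++ [z + 1]).map
        (Function.update (Function.update M z false) (z + 1) true)) = 2 ^ dst.length := by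
      simp only [List.map_append, List.map_replicate, List.map_cons, List.map_nil,
        Function.update_self, bitsToNat]
      rw [Function.update_of_ne (by omega), Function.update_self, Nat.ofDigits_append]
      simp [Nat.ofDigits_replicate_zero]
    simp only [coinGates, runGates, Gate.step, PMF.pure_bind, PMF.bind_pure, h]
    have := congrArg (PMF.map (Memory.write
      (Function.update (Function.update M z false) (z + 1) true) dst))
      (uniformBelow_two_pow_map dst.length)
    rw [PMF.map_comp, PMF.map_comp] at this
    exact this

/-- Output `k` uniformly random bits. -/
def coinsC (k : ℕ) : Circuit := ⟨coinGates (List.range k) k, k⟩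

theorem coinsC_run (O : Oracle) (k : ℕ) (w : List Bool) :
    (coinsC k).run O w = (PMF.uniformOfFintype (Bits k)).map List.ofFn := by
  have key : ∀ k' (h : k' = k) (M : Memory), PMF.map (fun N : Memory => (List.range k).map N)
      ((PMF.uniformOfFintype (Bits k')).map fun u => M.write (List.range k) (List.ofFn u)) =
      (PMF.uniformOfFintype (Bits k)).map List.ofFn := by
    rintro k' rfl M
    rw [PMF.map_comp]
    congr 1
    funext u
    exact Memory.map_write List.nodup_range _ (by simp)
  obtain ⟨M, -, h⟩ := runGates_coinGates O (List.range k) k (Memory.load w)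
  simp only [coinsC, Circuit.run, h]
  exact key _ (by simp) M

theorem coinsC_size (k : ℕ) : (coinsC k).size ≤ 6 + 3 * k := by
  simp only [coinsC, coinGates, Circuit.size_eq, gatesSize_cons, gatesSize_nil, Gate.size,
    List.length_range, List.length_append, List.length_replicate, List.length_cons,
    List.length_nil]
  omega

/-- On input `N` in binary, output a uniform number below `N` in binary. -/
def belowC (n : ℕ) : Circuit := ⟨[.sample (List.range n) (List.range n)], n⟩

theorem belowC_run (O : Oracle) {n N : ℕ} (h : N < 2 ^ n) :
    (belowC n).run O (natToBits n N) = (uniformBelow N).map (natToBits n) := by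
  have h1 : (List.range n).map (Memory.load (natToBits n N)) = natToBits n N := by
    simpa using Memory.range_map_load (natToBits n N)
  simp only [belowC, Circuit.run, runGates, Gate.step, PMF.bind_pure, h1, bitsToNat_natToBits h,
    PMF.map_comp]
  congr 1
  funext x
  rw [Function.comp_apply, List.length_range]
  exact Memory.map_write (dst := List.range n) List.nodup_range (Memory.load (natToBits n N))
    (w := natToBits n x) (by simp)

theorem belowC_size (n : ℕ) : (belowC n).size ≤ 1 + 3 * n := by
  simp only [belowC, Circuit.size_eq, gatesSize_cons, gatesSize_nil, Gate.size, List.length_range]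
  omega

/-! ### Polynomial bounds -/

namespace PolyBounded

variable {f g : ℕ → ℕ}

theorem mono (hg : PolyBounded g) (h : ∀ n, f n ≤ g n) : PolyBounded f :=
  hg.imp fun _ hP n => (h n).trans (hP n)

protected theorem const (c : ℕ) : PolyBounded fun _ => c := ⟨.C c, fun n => by simp⟩

protected theorem id : PolyBounded fun n => n := ⟨.X, fun n => by simp⟩

theorem add (hf : PolyBounded f) (hg : PolyBounded g) : PolyBounded fun n => f n + g n := by
  obtain ⟨P, hP⟩ := hf
  obtain ⟨Q, hQ⟩ := hg
  exact ⟨P + Q, fun n => by simpa using Nat.add_le_add (hP n) (hQ n)⟩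

theorem mul (hf : PolyBounded f) (hg : PolyBounded g) : PolyBounded fun n => f n * g n := by
  obtain ⟨P, hP⟩ := hf
  obtain ⟨Q, hQ⟩ := hg
  exact ⟨P * Q, fun n => by simpa using Nat.mul_le_mul (hP n) (hQ n)⟩

theorem const_mul (c : ℕ) (hf : PolyBounded f) : PolyBounded fun n => c * f n :=
  (PolyBounded.const c).mul hf

theorem list_sum {α : Type*} (l : List α) (F : α → ℕ → ℕ) (h : ∀ a ∈ l, PolyBounded (F a)) :
    PolyBounded fun n => (l.map fun a => F a n).sum := by
  induction l with
  | nil => exact PolyBounded.const 0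
  | cons a l ih =>
    simp only [List.mem_cons, forall_eq_or_imp] at h
    simpa using h.1.add (ih h.2)

end PolyBounded

theorem IsPPT.outLen {A : ℕ → Circuit} (h : IsPPT A) : PolyBounded fun n => (A n).outLen :=
  PolyBounded.mono h fun n => by rw [Circuit.size_eq]; exact Nat.le_add_right _ _

/-- A family of straight-line programs of constant length. -/
abbrev FProg := List (List ℕ × (ℕ → Circuit))

/-- The member of a family of programs for the security parameter `n`. -/
def FProg.at (P : FProg) (n : ℕ) : Prog := P.map fun e => (e.1, e.2 n)

theorem FProg.isPPT {P : FProg} {ℓ : ℕ → ℕ} {out : List ℕ} (h : ∀ e ∈ P, IsPPT e.2)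
    (hℓ : PolyBounded ℓ) : IsPPT fun n => (P.at n).circuit (ℓ n) out := by
  have h1 := PolyBounded.list_sum P (fun e n => (e.2 n).size) h
  have h2 := PolyBounded.list_sum P (fun e n => (e.2 n).outLen) fun e he => (h e he).outLen
  refine PolyBounded.mono (h1.add (.const_mul 17 (.mul
    (.const ((P.map fun e => e.1.length).sum + out.length)) (hℓ.add h2)))) fun n => ?_
  simpa [FProg.at, Function.comp_def] using (P.at n).circuit_size_le (ℓ n) out

theorem isPPT_sliceC (s : ℕ → ℕ) {l : ℕ → ℕ} (h : PolyBounded l) :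
    IsPPT fun n => sliceC (s n) (l n) :=
  PolyBounded.mono (h.const_mul 17) fun _ => sliceC_size _ _

theorem isPPT_xorC {l : ℕ → ℕ} (h : PolyBounded l) : IsPPT fun n => xorC (l n) :=
  PolyBounded.mono (h.const_mul 100) fun _ => xorC_size _

theorem isPPT_muxC {l : ℕ → ℕ} (h : PolyBounded l) : IsPPT fun n => muxC (l n) :=
  PolyBounded.mono (h.const_mul 100) fun _ => muxC_size _

theorem isPPT_queryC {ℓ k : ℕ → ℕ} (hℓ : PolyBounded ℓ) (hk : PolyBounded k) :
    IsPPT fun n => queryC (ℓ n) (k n) :=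
  PolyBounded.mono (((PolyBounded.const 1).add (hk.const_mul 2)).add hℓ) fun _ => queryC_size _ _

theorem isPPT_coinsC {k : ℕ → ℕ} (h : PolyBounded k) : IsPPT fun n => coinsC (k n) :=
  PolyBounded.mono ((PolyBounded.const 6).add (h.const_mul 3)) fun _ => coinsC_size _

theorem isPPT_belowC : IsPPT fun n => belowC n :=
  PolyBounded.mono ((PolyBounded.const 1).add (PolyBounded.id.const_mul 3)) fun _ => belowC_size _

/-! ### Parsing -/

theorem Prog.eval_append (O : Oracle) (P Q : Prog) (env : List (List Bool)) :
    Prog.eval O (P ++ Q) env = (P.eval O env).bind (Q.eval O) := by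
  induction P generalizing env with
  | nil => simp [Prog.eval]
  | cons e P ih =>
    obtain ⟨src, A⟩ := e
    simp only [List.cons_append, Prog.eval, PMF.bind_bind]
    congr 1
    funext o
    exact ih _

/-- The program that cuts the initial block, from position `s` on, into blocks of the given
lengths. -/
def parseP : ℕ → List ℕ → Prog
  | _, [] => []
  | s, l :: ls => ([0], sliceC s l) :: parseP (s + l) ls

theorem parseP_eval (O : Oracle) (pre : List Bool) (bs : List (List Bool))
    (env : List (List Bool)) :
    Prog.eval O (parseP pre.length (bs.map List.length)) ((pre ++ bs.flatten) :: env) =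
      PMF.pure ((pre ++ bs.flatten) :: (env ++ bs)) := by
  induction bs generalizing pre env with
  | nil => simp [parseP, Prog.eval]
  | cons b bs ih =>
    have h := ih (pre ++ b) (env ++ [b])
    simp only [List.length_append, List.append_assoc] at h
    simp only [List.map_cons, parseP, Prog.eval, gather, List.flatMap_cons, List.flatMap_nil,
      List.append_nil, List.getD_cons_zero, List.flatten_cons]
    rw [sliceC_run O pre b bs.flatten (by simp) rfl rfl, PMF.pure_bind]
    simpa using h

/-- The family of parsing programs for blocks of the given lengths. -/
def parseF : (ℕ → ℕ) → List (ℕ → ℕ) → FProg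
  | _, [] => []
  | s, l :: ls => ([0], fun n => sliceC (s n) (l n)) :: parseF (fun n => s n + l n) ls

theorem parseF_at (s : ℕ → ℕ) (ls : List (ℕ → ℕ)) (n : ℕ) :
    (parseF s ls).at n = parseP (s n) (ls.map fun l => l n) := by
  induction ls generalizing s with
  | nil => rfl
  | cons l ls ih =>
    have := ih fun n => s n + l n
    simp only [FProg.at] at this
    simp [parseF, parseP, FProg.at, this]

theorem isPPT_parseF (s : ℕ → ℕ) (ls : List (ℕ → ℕ)) (h : ∀ l ∈ ls, PolyBounded l) :
    ∀ e ∈ parseF s ls, IsPPT e.2 := by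
  induction ls generalizing s with
  | nil => simp [parseF]
  | cons l ls ih =>
    simp only [List.mem_cons, forall_eq_or_imp] at h
    simp only [parseF, List.mem_cons, forall_eq_or_imp]
    exact ⟨isPPT_sliceC _ h.1, ih _ h.2⟩

theorem FProg.at_append (P Q : FProg) (n : ℕ) : FProg.at (P ++ Q) n = P.at n ++ Q.at n := by
  simp [FProg.at]

/-- A family of programs that parses its input and continues with `P`. -/
theorem FProg.parse_circuit_run (O : Oracle) (P : FProg) (ls : List (ℕ → ℕ)) (n ℓ : ℕ)
    (out : List ℕ) (bs : List (List Bool)) (h : bs.map List.length = ls.map fun l => l n)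
    (hℓ : bs.flatten.length = ℓ) :
    ((FProg.at (parseF (fun _ => 0) ls ++ P) n).circuit ℓ out).run O bs.flatten =
      ((P.at n).eval O (bs.flatten :: bs)).map fun env => gather env out := by
  have := parseP_eval O [] bs []
  simp only [List.length_nil, List.nil_append] at this
  rw [Prog.circuit_run O _ _ _ hℓ, FProg.at_append, Prog.eval_append, parseF_at, ← h, this,
    PMF.pure_bind]

/-! ### Group operations as circuits -/

namespace GroupGen

section Expo

variable {G : GroupGen} {n : ℕ} {d : Bits (G.descLen n)}

theorem pow_mod_order (h : G.Elt n d) (k : ℕ) : h ^ (k % G.order n d) = h ^ k := by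
  rw [← G.card_elt n d]
  exact pow_mod_natCard h k

theorem expo_add (h : G.Elt n d) (x y : G.Expo n d) : expo h (x + y) = expo h x * expo h y := by
  rw [expo, ZMod.val_add, pow_mod_order, pow_add, expo, expo]

theorem expo_mul (h : G.Elt n d) (x y : G.Expo n d) : expo h (x * y) = expo (expo h x) y := by
  rw [expo, ZMod.val_mul, pow_mod_order, pow_mul, expo, expo]

theorem expo_zero (h : G.Elt n d) : expo h (0 : G.Expo n d) = 1 := by
  simp [expo]

theorem expo_neg (h : G.Elt n d) (x : G.Expo n d) : expo h (-x) = (expo h x)⁻¹ :=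
  eq_inv_of_mul_eq_one_left (by rw [← expo_add, neg_add_cancel, expo_zero])

theorem expo_sub (h : G.Elt n d) (x y : G.Expo n d) : expo h (x - y) = expo h x / expo h y := by
  rw [sub_eq_add_neg, expo_add, expo_neg, div_eq_mul_inv]

@[simp] theorem length_eltBits (h : G.Elt n d) : (eltBits h).length = G.eltLen n := by
  simp [eltBits]

@[simp] theorem length_expoBits (x : G.Expo n d) : (expoBits x).length = n := by
  simp [expoBits]

@[simp] theorem length_paramBits : (G.paramBits n d).length = G.descLen n + n + G.eltLen n := by
  simp [paramBits, add_assoc]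

theorem val_lt_two_pow (hn : 2 ≤ n) (x : G.Expo n d) : x.val < 2 ^ n :=
  (ZMod.val_lt x).trans (G.order_size n d hn).2

end Expo

variable (G : GroupGen)

/-- The circuits of the group generator. -/
noncomputable def genC : ℕ → Circuit := G.gen_ppt.choose

/-- Circuits for the group multiplication. -/
noncomputable def mulC : ℕ → Circuit := G.mul_ppt.choose

/-- Circuits for the inversion in the groups. -/
noncomputable def invC : ℕ → Circuit := G.inv_ppt.choose

theorem isPPT_genC : IsPPT G.genC := G.gen_ppt.choose_spec.1

theorem isPPT_mulC : IsPPT G.mulC := G.mul_ppt.choose_spec.1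

theorem isPPT_invC : IsPPT G.invC := G.inv_ppt.choose_spec.1

theorem genC_run (O : Oracle) (n : ℕ) (ρ : Bits (G.coinLen n)) :
    (G.genC n).run O (List.ofFn ρ) = PMF.pure (G.paramBits n (G.gen n ρ)) :=
  G.gen_ppt.choose_spec.2 n ρ O

theorem mulC_run (O : Oracle) (n : ℕ) (ρ : Bits (G.coinLen n)) (h k : G.Elt n (G.gen n ρ)) :
    (G.mulC n).run O (List.ofFn (G.gen n ρ) ++ (eltBits h ++ eltBits k)) =
      PMF.pure (eltBits (h * k)) := by
  have := G.mul_ppt.choose_spec.2 n ρ O h k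
  rwa [List.append_assoc] at this

theorem invC_run (O : Oracle) (n : ℕ) (ρ : Bits (G.coinLen n)) (h : G.Elt n (G.gen n ρ)) :
    (G.invC n).run O (List.ofFn (G.gen n ρ) ++ eltBits h) = PMF.pure (eltBits h⁻¹) :=
  G.inv_ppt.choose_spec.2 n ρ O h

/-- The lengths of descriptions and of elements are not bounded by assumption; the bound comes from
the circuit that outputs them. -/
theorem gen_lengths_le (n : ℕ) : G.descLen n + n + G.eltLen n ≤ (G.genC n).outLen := by
  have h := G.genC_run noOracle n fun _ => false
  have h1 : G.paramBits n (G.gen n fun _ => false) ∈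
      ((G.genC n).run noOracle (List.ofFn fun _ : Fin (G.coinLen n) => false)).support := by
    rw [h]; simp
  rw [Circuit.run, PMF.support_map] at h1
  obtain ⟨M, -, hM⟩ := h1
  have := congrArg List.length hM
  simp only [List.length_map, List.length_range, length_paramBits] at this
  exact this.ge

theorem descLen_poly : PolyBounded G.descLen :=
  G.isPPT_genC.outLen.mono fun n => by have := G.gen_lengths_le n; omega

theorem eltLen_poly : PolyBounded G.eltLen :=
  G.isPPT_genC.outLen.mono fun n => by have := G.gen_lengths_le n; omega

/-- Circuits for the exponentiation with a `k`-bit exponent by repeated squaring. The input consists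
of the description of the group, the base, the neutral element, and the exponent. -/
noncomputable def powAux (n : ℕ) : ℕ → Circuit
  | 0 => sliceC (G.descLen n + G.eltLen n) (G.eltLen n)
  | k + 1 => Prog.circuit
      (parseP 0 [G.descLen n, G.eltLen n, G.eltLen n, 1, k] ++
        [([1, 2, 3, 5], powAux n k), ([1, 6, 6], G.mulC n), ([1, 7, 2], G.mulC n),
          ([4, 8, 7], muxC (G.eltLen n))])
      (G.descLen n + G.eltLen n + G.eltLen n + 1 + k) [9]

theorem powAux_run (O : Oracle) (n : ℕ) (ρ : Bits (G.coinLen n)) (h : G.Elt n (G.gen n ρ))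
    (k x : ℕ) (hx : x < 2 ^ k) :
    (G.powAux n k).run O (List.ofFn (G.gen n ρ) ++ (eltBits h ++
      (eltBits (1 : G.Elt n (G.gen n ρ)) ++ natToBits k x))) = PMF.pure (eltBits (h ^ x)) := by
  induction k generalizing x with
  | zero =>
    obtain rfl : x = 0 := by simpa using hx
    rw [powAux, pow_zero]
    exact sliceC_run O (List.ofFn (G.gen n ρ) ++ eltBits h) _ [] (by simp [natToBits]) (by simp)
      (by simp)
  | succ k ih =>
    have hp := parseP_eval O [] [List.ofFn (G.gen n ρ), eltBits h,
      eltBits (1 : G.Elt n (G.gen n ρ)), [x.testBit 0], natToBits k (x / 2)] []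
    simp only [List.length_nil, List.map_cons, List.map_nil, List.length_ofFn, length_eltBits,
      List.length_cons, zero_add, length_natToBits, List.flatten_cons, List.flatten_nil,
      List.nil_append, List.append_nil, List.cons_append] at hp
    -- `h ^ x` is `(h ^ (x / 2)) ^ 2`, times `h` if the low-order bit of `x` is set
    have hsq : h ^ (x / 2) * h ^ (x / 2) = h ^ (2 * (x / 2)) := by
      rw [← pow_add]; congr 1; omega
    rw [natToBits_succ, powAux, Prog.circuit_run _ _ _ _ (by simp; omega), Prog.eval_append, hp]
    simp only [PMF.pure_bind, Prog.eval, gather, List.flatMap_cons, List.flatMap_nil,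
      List.append_nil, List.getD_cons_succ, List.getD_cons_zero, List.cons_append, List.nil_append,
      ih (x / 2) (by rw [pow_succ] at hx; omega), mulC_run]
    rw [muxC_run _ _ _ _ (by simp) (by simp)]
    simp only [PMF.pure_bind, List.getD_cons_succ, List.getD_cons_zero, PMF.pure_map, hsq,
      ← pow_succ]
    congr 1
    have h2 := Nat.mod_add_div x 2
    rcases Nat.mod_two_eq_zero_or_one x with h1 | h1
    · rw [show 2 * (x / 2) = x by omega]
      simp [Nat.testBit_zero, h1]
    · rw [show 2 * (x / 2) + 1 = x by omega]
      simp [Nat.testBit_zero, h1]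

theorem powAux_outLen (n k : ℕ) : (G.powAux n k).outLen = G.eltLen n := by
  cases k with
  | zero => simp [powAux, sliceC, formC]
  | succ k => simp [powAux, Prog.circuit, Prog.code, parseP, gather, muxC, formC]

theorem powAux_size_le (n k : ℕ) (hk : k ≤ n) :
    (G.powAux n k).size ≤ 17 * G.eltLen n + k * (3000 * (G.descLen n + G.eltLen n + n + 1 +
      (G.mulC n).size)) := by
  induction k with
  | zero => simpa [powAux] using sliceC_size _ _
  | succ k ih =>
    have h1 := Prog.circuit_size_le (parseP 0 [G.descLen n, G.eltLen n, G.eltLen n, 1, k] ++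
        [([1, 2, 3, 5], G.powAux n k), ([1, 6, 6], G.mulC n), ([1, 7, 2], G.mulC n),
          ([4, 8, 7], muxC (G.eltLen n))])
      (G.descLen n + G.eltLen n + G.eltLen n + 1 + k) [9]
    have h2 := sliceC_size 0 (G.descLen n)
    have h3 := sliceC_size (0 + G.descLen n) (G.eltLen n)
    have h4 := sliceC_size (0 + G.descLen n + G.eltLen n) (G.eltLen n)
    have h5 := sliceC_size (0 + G.descLen n + G.eltLen n + G.eltLen n) 1
    have h6 := sliceC_size (0 + G.descLen n + G.eltLen n + G.eltLen n + 1) k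
    have h7 := muxC_size (G.eltLen n)
    have h8 : (G.mulC n).outLen ≤ (G.mulC n).size := by
      rw [Circuit.size_eq]; exact Nat.le_add_right _ _
    have hs : ∀ s l, (sliceC s l).outLen = l := fun s l => by simp [sliceC, formC]
    have hm : ∀ l, (muxC l).outLen = l := fun l => by simp [muxC, formC]
    simp only [parseP, List.cons_append, List.nil_append, List.map_cons, List.map_nil,
      List.sum_cons, List.sum_nil, hs, hm, powAux_outLen, List.length_cons, List.length_nil] at h1
    have h9 := ih (by omega)
    rw [powAux, Nat.add_mul]
    simp only [parseP, List.cons_append, List.nil_append]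
    omega

/-- The program for the exponentiation with `n`-bit exponents. The input consists of the description
of the group, the base, and the exponent; the neutral element is computed as `h * h⁻¹`. -/
noncomputable def powF : FProg :=
  parseF (fun _ => 0) [G.descLen, G.eltLen, fun n => n] ++
    [([1, 2], G.invC), ([1, 2, 4], G.mulC), ([1, 2, 5, 3], fun n => G.powAux n n)]

/-- The circuits for `powF`. -/
noncomputable def powC (n : ℕ) : Circuit :=
  (G.powF.at n).circuit (G.descLen n + G.eltLen n + n) [6]

theorem isPPT_powC : IsPPT G.powC := by
  refine FProg.isPPT (fun e he => ?_) ((G.descLen_poly.add G.eltLen_poly).add PolyBounded.id)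
  rcases List.mem_append.1 he with he | he
  · refine isPPT_parseF _ _ ?_ e he
    simpa using ⟨G.descLen_poly, G.eltLen_poly, PolyBounded.id⟩
  · simp only [List.mem_cons, List.not_mem_nil, or_false] at he
    rcases he with rfl | rfl | rfl
    · exact G.isPPT_invC
    · exact G.isPPT_mulC
    · refine PolyBounded.mono ((G.eltLen_poly.const_mul 17).add (PolyBounded.id.mul
        (.const_mul 3000 (.add (.add (.add (.add G.descLen_poly G.eltLen_poly) .id) (.const 1))
          G.isPPT_mulC)))) fun n => G.powAux_size_le n n le_rfl

theorem powC_run (O : Oracle) {n : ℕ} (hn : 2 ≤ n) (ρ : Bits (G.coinLen n))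
    (h : G.Elt n (G.gen n ρ)) (x : G.Expo n (G.gen n ρ)) :
    (G.powC n).run O (List.ofFn (G.gen n ρ) ++ (eltBits h ++ expoBits x)) =
      PMF.pure (eltBits (expo h x)) := by
  have := FProg.parse_circuit_run O [([1, 2], G.invC), ([1, 2, 4], G.mulC),
    ([1, 2, 5, 3], fun n => G.powAux n n)] [G.descLen, G.eltLen, fun n => n] n
    (G.descLen n + G.eltLen n + n) [6] [List.ofFn (G.gen n ρ), eltBits h, expoBits x] (by simp)
    (by simp; omega)
  simp only [List.flatten_cons, List.flatten_nil, List.append_nil] at this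
  rw [powC, powF, this]
  simp only [FProg.at, List.map_cons, List.map_nil, Prog.eval, gather, List.flatMap_cons,
    List.flatMap_nil, List.append_nil, List.getD_cons_succ, List.getD_cons_zero, List.cons_append,
    List.nil_append, invC_run, mulC_run, PMF.pure_bind, mul_inv_cancel, expoBits,
    powAux_run G O n ρ h n x.val (val_lt_two_pow hn x), PMF.pure_map]
  rfl

theorem belowC_run (O : Oracle) {n : ℕ} (hn : 2 ≤ n) (d : Bits (G.descLen n)) :
    (belowC n).run O (natToBits n (G.order n d)) =
      (PMF.uniformOfFintype (G.Expo n d)).map expoBits := by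
  rw [DQOT.belowC_run O (G.order_size n d hn).2,
    uniformBelow_eq_map (ZMod.val : G.Expo n d → ℕ) (ZMod.val_injective _) ZMod.val_lt
      (ZMod.card _), PMF.map_comp]
  rfl

end GroupGen

open GroupGen

theorem coinsC_one_run (O : Oracle) (w : List Bool) :
    (coinsC 1).run O w = (PMF.uniformOfFintype Bool).map fun b => [b] := by
  rw [coinsC_run, ← uniformOfFintype_map_equiv (Equiv.funUnique (Fin 1) Bool), PMF.map_comp]
  congr 1


/-! ### Correctness -/

section Correctness

variable {G : GroupGen} {n k : ℕ} (c : Coins G n) (H : Hash k) (m : Messages k) (s : Bool)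

/-- The secret exponent of `R`. -/
def Coins.x : G.Expo n c.desc := c.r₂ + c.r₁ * (-1) ^ (c.s₂ s).toNat

theorem Coins.β_self : c.β s s = expo (G.g n c.desc) (c.x s) := by
  unfold Coins.β queryP₁ Coins.δ queryP₂ Coins.x Coins.s₁ Coins.s₂ share
  cases s <;> cases c.b <;> simp [expo_add, expo_neg, div_eq_mul_inv]

theorem Coins.β_not : c.β s (!s) = c.C / expo (G.g n c.desc) (c.x s) := by
  unfold Coins.β queryP₁ Coins.δ queryP₂ Coins.x Coins.s₁ Coins.s₂ share
  cases s <;> cases c.b <;>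
    simp [expo_add, expo_neg, div_eq_mul_inv, mul_comm, mul_left_comm]

theorem Coins.β_mul : c.β s false * c.β s true = c.C := by
  have h1 := c.β_self s
  have h2 := c.β_not s
  cases s
  · rw [Bool.not_false] at h2; rw [h1, h2, mul_div_cancel]
  · rw [Bool.not_true] at h2; rw [h1, h2, div_mul_cancel]

theorem Coins.res_eq : c.res H m s = some fun i => (expo (G.g n c.desc) (c.y i),
    bxor (H (eltBits (expo (c.β s i) (c.y i)))) (m i)) :=
  if_pos (c.β_mul s)

theorem bxor_bxor_cancel {k : ℕ} (u v : Bits k) : bxor u (bxor u v) = v := by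
  funext i
  simp [bxor]

theorem Coins.output_eq : c.output H m s = some (m s) := by
  have hs : xor (c.s₁ s) (c.s₂ s) = s := by simp [Coins.s₁, Coins.s₂, share]
  rw [Coins.output, Coins.res_eq, Option.map_some, retrieve, hs, ← Coins.x, c.β_self,
    ← expo_mul, ← expo_mul, mul_comm, bxor_bxor_cancel]

theorem correct (G : GroupGen) (σ : ℕ → ℕ) : Correct G σ := fun _ H m s c => c.output_eq H m s

end Correctness

/-! ### Perfect simulation of the sender and of the proxies -/

section Simulators

variable (G : GroupGen)

/-- The program that draws a description of a group: the blocks `1, …, 5` are the coins, the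
parameters, the description, the order and the generator. -/
noncomputable def genF : FProg :=
  [([], fun n => coinsC (G.coinLen n)), ([1], G.genC), ([2], fun n => sliceC 0 (G.descLen n)),
    ([2], fun n => sliceC (G.descLen n) n), ([2], fun n => sliceC (G.descLen n + n) (G.eltLen n))]

theorem isPPT_genF : ∀ e ∈ genF G, IsPPT e.2 := by
  simp only [genF, List.mem_cons, List.not_mem_nil, or_false, forall_eq_or_imp, forall_eq]
  exact ⟨isPPT_coinsC G.coinLen_poly, G.isPPT_genC, isPPT_sliceC _ G.descLen_poly,
    isPPT_sliceC _ PolyBounded.id, isPPT_sliceC _ G.eltLen_poly⟩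

theorem genF_eval (O : Oracle) (P : FProg) (n : ℕ) (w : List Bool) :
    (FProg.at (genF G ++ P) n).eval O [w] =
      (PMF.uniformOfFintype (Bits (G.coinLen n))).bind fun ρ => (P.at n).eval O
        [w, List.ofFn ρ, G.paramBits n (G.gen n ρ), List.ofFn (G.gen n ρ),
          natToBits n (G.order n (G.gen n ρ)), eltBits (G.g n (G.gen n ρ))] := by
  rw [FProg.at_append, Prog.eval_append]
  simp only [genF, FProg.at, List.map_cons, List.map_nil, Prog.eval, gather, List.flatMap_cons,
    List.flatMap_nil, List.append_nil, coinsC_run, PMF.bind_map, Function.comp_def,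
    List.cons_append, List.nil_append, List.getD_cons_succ, List.getD_cons_zero, genC_run,
    PMF.pure_bind, PMF.bind_bind]
  congr 1
  funext ρ
  rw [sliceC_run (s := 0) (l := G.descLen n) O [] (List.ofFn (G.gen n ρ))
      (natToBits n (G.order n (G.gen n ρ)) ++ eltBits (G.g n (G.gen n ρ)))
      (by simp [paramBits]) rfl (by simp),
    PMF.pure_bind,
    sliceC_run (w := G.paramBits n (G.gen n ρ)) O (List.ofFn (G.gen n ρ)) (natToBits n (G.order n (G.gen n ρ)))
      (eltBits (G.g n (G.gen n ρ))) rfl (by simp) (by simp),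
    PMF.pure_bind,
    sliceC_run (w := G.paramBits n (G.gen n ρ)) O (List.ofFn (G.gen n ρ) ++ natToBits n (G.order n (G.gen n ρ)))
      (eltBits (G.g n (G.gen n ρ))) [] (by simp [paramBits]) (by simp) (by simp),
    PMF.pure_bind]

/-- The simulator of `P₂`: a key, a coin, and a uniform exponent. In this simulator, as in those of
`P₁` and `S`, the blocks `6` and `7` are the secret exponent `a` and `C = g ^ a`. -/
noncomputable def simP₂F : FProg := genF G ++
  [([4], belowC), ([3, 5, 6], G.powC), ([], fun _ => coinsC 1), ([4], belowC)]

/-- The simulator of `P₁`: the two elements that it receives are a uniform group element and its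
cofactor in `C`. -/
noncomputable def simP₁F : FProg := genF G ++
  [([4], belowC), ([3, 5, 6], G.powC), ([], fun _ => coinsC 1), ([4], belowC), ([4], belowC),
    ([3, 5, 10], G.powC), ([3, 11], G.invC), ([3, 7, 12], G.mulC)]

/-- The simulator of `S`: the two elements that it receives are a uniform group element and its
cofactor in `C`. -/
noncomputable def simSF : FProg := genF G ++
  [([4], belowC), ([3, 5, 6], G.powC), ([4], belowC), ([4], belowC), ([4], belowC),
    ([3, 5, 10], G.powC), ([3, 11], G.invC), ([3, 7, 12], G.mulC)]

theorem isPPT_simP₂F : ∀ e ∈ simP₂F G, IsPPT e.2 := by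
  refine List.forall_mem_append.2 ⟨isPPT_genF G, ?_⟩
  simp only [List.mem_cons, List.not_mem_nil, or_false, forall_eq_or_imp, forall_eq]
  exact ⟨isPPT_belowC, G.isPPT_powC, isPPT_coinsC (.const 1), isPPT_belowC⟩

theorem isPPT_simP₁F : ∀ e ∈ simP₁F G, IsPPT e.2 := by
  refine List.forall_mem_append.2 ⟨isPPT_genF G, ?_⟩
  simp only [List.mem_cons, List.not_mem_nil, or_false, forall_eq_or_imp, forall_eq]
  exact ⟨isPPT_belowC, G.isPPT_powC, isPPT_coinsC (.const 1), isPPT_belowC, isPPT_belowC,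
    G.isPPT_powC, G.isPPT_invC, G.isPPT_mulC⟩

theorem isPPT_simSF : ∀ e ∈ simSF G, IsPPT e.2 := by
  refine List.forall_mem_append.2 ⟨isPPT_genF G, ?_⟩
  simp only [List.mem_cons, List.not_mem_nil, or_false, forall_eq_or_imp, forall_eq]
  exact ⟨isPPT_belowC, G.isPPT_powC, isPPT_belowC, isPPT_belowC, isPPT_belowC,
    G.isPPT_powC, G.isPPT_invC, G.isPPT_mulC⟩

/-- Translation of bits. -/
def xorEquiv (s : Bool) : Bool ≃ Bool where
  toFun b := xor b s
  invFun b := xor b s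
  left_inv b := by simp
  right_inv b := by simp

variable {G} {n k : ℕ}

/-- A function of the coins, pushed forward through their distribution. The right-hand side is free
of projections of `Coins`, so that unused coins can be discarded. -/
theorem Coins.dist_map {α : Type} (f : Coins G n → α)
    (F : ∀ ρ : Bits (G.coinLen n), G.Expo n (G.gen n ρ) → Bool → G.Expo n (G.gen n ρ) →
      G.Expo n (G.gen n ρ) → (Bool → G.Expo n (G.gen n ρ)) → α)
    (h : ∀ ρ a b r₁ r₂ y, f ⟨ρ, a, b, r₁, r₂, y⟩ = F ρ a b r₁ r₂ y) :
    (Coins.dist G n).map f =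
      (PMF.uniformOfFintype (Bits (G.coinLen n))).bind fun ρ =>
      (PMF.uniformOfFintype (G.Expo n (G.gen n ρ))).bind fun a =>
      (PMF.uniformOfFintype Bool).bind fun b =>
      (PMF.uniformOfFintype (G.Expo n (G.gen n ρ))).bind fun r₁ =>
      (PMF.uniformOfFintype (G.Expo n (G.gen n ρ))).bind fun r₂ =>
      (PMF.uniformOfFintype (G.Expo n (G.gen n ρ))).bind fun y₀ =>
      (PMF.uniformOfFintype (G.Expo n (G.gen n ρ))).bind fun y₁ =>
        PMF.pure (F ρ a b r₁ r₂ fun i => if i then y₁ else y₀) := by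
  simp only [Coins.dist, PMF.map_bind, PMF.pure_map, ← h]

theorem simP₂_run (hn : 2 ≤ n) (O : Oracle) (H : Hash k) (m : Messages k) (s : Bool)
    (w : List Bool) :
    (((simP₂F G).at n).circuit w.length [2, 7, 8, 9]).run O w =
      (Coins.dist G n).map fun c => c.view H m s .P₂ := by
  rw [Prog.circuit_run O _ _ _ rfl, simP₂F, genF_eval]
  simp only [FProg.at, List.map_cons, List.map_nil, Prog.eval, gather, List.flatMap_cons,
    List.flatMap_nil, List.append_nil, PMF.bind_map, PMF.map_bind, Function.comp_def,
    List.cons_append, List.nil_append, List.getD_cons_succ, List.getD_cons_zero,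
    PMF.pure_bind, G.belowC_run O hn, G.powC_run O hn, coinsC_one_run, PMF.pure_map,
    Coins.dist, Coins.view, Coins.pkBits, Coins.C, Coins.s₂, Coins.desc, share, PMF.bind_const,
    List.append_assoc]
  congr 1; funext ρ
  congr 1; funext a
  -- `s₂` is the coin of the sharing, translated by `s`
  exact (uniformOfFintype_bind_equiv (xorEquiv s) _).symm

theorem simP₁_run (hn : 2 ≤ n) (O : Oracle) (H : Hash k) (m : Messages k) (s : Bool)
    (w : List Bool) :
    (((simP₁F G).at n).circuit w.length [2, 7, 8, 9, 11, 13]).run O w =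
      (Coins.dist G n).map fun c => c.view H m s .P₁ := by
  -- the exponent of `δ₀` is `r₂` or `a - r₂`, hence uniform, and `δ₁ = C / δ₀`
  have hview : ∀ (ρ : Bits (G.coinLen n)) (a : G.Expo n (G.gen n ρ)) (b : Bool)
      (r₁ r₂ : G.Expo n (G.gen n ρ)) (y : Bool → G.Expo n (G.gen n ρ)),
      (⟨ρ, a, b, r₁, r₂, y⟩ : Coins G n).view H m s .P₁ =
      (fun r => G.paramBits n (G.gen n ρ) ++ (eltBits (expo (G.g n (G.gen n ρ)) a) ++ (b ::
        (expoBits r₁ ++ (eltBits (expo (G.g n (G.gen n ρ)) r) ++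
          eltBits (expo (G.g n (G.gen n ρ)) a * (expo (G.g n (G.gen n ρ)) r)⁻¹))))))
      (if xor b s then a - r₂ else r₂) := by
    intro ρ a b r₁ r₂ y
    simp only [Coins.view, Coins.pkBits, Coins.C, Coins.s₁, Coins.δ, Coins.s₂, share,
      List.append_assoc, List.cons_append, List.nil_append]
    cases xor b s
    · simp [queryP₂, div_eq_mul_inv]
    · simp [queryP₂, expo_sub]
  rw [Coins.dist_map _ _ hview, Prog.circuit_run O _ _ _ rfl, simP₁F, genF_eval]
  simp only [FProg.at, List.map_cons, List.map_nil, Prog.eval, gather, List.flatMap_cons,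
    List.flatMap_nil, List.append_nil, PMF.bind_map, PMF.map_bind, Function.comp_def,
    List.cons_append, List.nil_append, List.getD_cons_succ, List.getD_cons_zero,
    PMF.pure_bind, G.belowC_run O hn, G.powC_run O hn, G.mulC_run, G.invC_run, coinsC_one_run,
    PMF.pure_map, PMF.bind_const]
  congr 1; funext ρ
  congr 1; funext a
  congr 1; funext b
  congr 1; funext r₁
  cases xor b s
  · rfl
  · exact (uniformOfFintype_bind_equiv (Equiv.subLeft a) _).symm

theorem simS_run (hn : 2 ≤ n) (O : Oracle) (H : Hash k) (m : Messages k) (s : Bool)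
    (w : List Bool) (hw : w = List.ofFn (m false) ++ List.ofFn (m true)) :
    (((simSF G).at n).circuit w.length [0, 1, 6, 8, 9, 2, 7, 11, 13]).run O w =
      (Coins.dist G n).map fun c => c.view H m s .S := by
  -- the exponent of `β₀` is `x` or `a - x`, hence uniform, and `β₁ = C / β₀`
  have key : ∀ (ρ : Bits (G.coinLen n)) (a : G.Expo n (G.gen n ρ)) (b : Bool)
      (F : G.Expo n (G.gen n ρ) → PMF (List Bool)),
      ((PMF.uniformOfFintype (G.Expo n (G.gen n ρ))).bind fun r₁ =>
        (PMF.uniformOfFintype (G.Expo n (G.gen n ρ))).bind fun r₂ =>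
          F (if s then a - (r₂ + r₁ * (-1) ^ (xor b s).toNat)
            else r₂ + r₁ * (-1) ^ (xor b s).toNat)) =
      (PMF.uniformOfFintype (G.Expo n (G.gen n ρ))).bind F := by
    intro ρ a b F
    have h1 : ∀ F' : G.Expo n (G.gen n ρ) → PMF (List Bool),
        ((PMF.uniformOfFintype (G.Expo n (G.gen n ρ))).bind fun r₁ =>
          (PMF.uniformOfFintype (G.Expo n (G.gen n ρ))).bind fun r₂ =>
            F' (r₂ + r₁ * (-1) ^ (xor b s).toNat)) =
        (PMF.uniformOfFintype (G.Expo n (G.gen n ρ))).bind F' := by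
      intro F'
      rw [← PMF.bind_const (PMF.uniformOfFintype (G.Expo n (G.gen n ρ)))
        ((PMF.uniformOfFintype (G.Expo n (G.gen n ρ))).bind F')]
      congr 1
      funext r₁
      exact uniformOfFintype_bind_equiv (Equiv.addRight (r₁ * (-1) ^ (xor b s).toNat)) F'
    cases s
    · exact h1 F
    · exact (h1 fun x => F (a - x)).trans (uniformOfFintype_bind_equiv (Equiv.subLeft a) F)
  have hβ : ∀ (c : Coins G n), c.β s false =
      expo (G.g n c.desc) (if s then c.a - c.x s else c.x s) := by
    intro c
    cases s
    · exact c.β_self false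
    · rw [if_pos rfl, expo_sub]; exact c.β_not true
  have hβ' : ∀ (c : Coins G n), c.β s true = c.C * (c.β s false)⁻¹ := fun c => by
    rw [← c.β_mul s, mul_inv_cancel_comm]
  have hview : ∀ (ρ : Bits (G.coinLen n)) (a : G.Expo n (G.gen n ρ)) (b : Bool)
      (r₁ r₂ : G.Expo n (G.gen n ρ)) (y : Bool → G.Expo n (G.gen n ρ)),
      (⟨ρ, a, b, r₁, r₂, y⟩ : Coins G n).view H m s .S =
      (fun r => w ++ (List.ofFn ρ ++ (expoBits a ++ (expoBits (y false) ++ (expoBits (y true) ++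
        (G.paramBits n (G.gen n ρ) ++ (eltBits (expo (G.g n (G.gen n ρ)) a) ++
          (eltBits (expo (G.g n (G.gen n ρ)) r) ++
            eltBits (expo (G.g n (G.gen n ρ)) a * (expo (G.g n (G.gen n ρ)) r)⁻¹)))))))))
      (if s then a - (r₂ + r₁ * (-1) ^ (xor b s).toNat)
        else r₂ + r₁ * (-1) ^ (xor b s).toNat) := by
    intro ρ a b r₁ r₂ y
    simp only [Coins.view, hβ', hβ, Coins.pkBits, hw, List.append_assoc, Coins.C]
    rfl
  rw [Coins.dist_map _ _ hview, Prog.circuit_run O _ _ _ rfl, simSF, genF_eval]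
  simp only [FProg.at, List.map_cons, List.map_nil, Prog.eval, gather, List.flatMap_cons,
    List.flatMap_nil, List.append_nil, PMF.bind_map, PMF.map_bind, Function.comp_def,
    List.cons_append, List.nil_append, List.getD_cons_succ, List.getD_cons_zero,
    PMF.pure_bind, G.belowC_run O hn, G.powC_run O hn, G.mulC_run, G.invC_run,
    PMF.pure_map, if_true, Bool.false_eq_true, if_false]
  congr 1; funext ρ
  congr 1; funext a
  refine Eq.trans ?_ ((congrArg (PMF.bind _) (funext fun b => key ρ a b fun r =>
    (PMF.uniformOfFintype (G.Expo n (G.gen n ρ))).bind fun y₀ =>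
      (PMF.uniformOfFintype (G.Expo n (G.gen n ρ))).bind fun y₁ => PMF.pure
        (w ++ (List.ofFn ρ ++ (expoBits a ++ (expoBits y₀ ++ (expoBits y₁ ++
        (G.paramBits n (G.gen n ρ) ++ (eltBits (expo (G.g n (G.gen n ρ)) a) ++
          (eltBits (expo (G.g n (G.gen n ρ)) r) ++
            eltBits (expo (G.g n (G.gen n ρ)) a *
              (expo (G.g n (G.gen n ρ)) r)⁻¹))))))))))).trans (PMF.bind_const _ _)).symm
  refine Eq.trans ?_ (PMF.bind_comm _ _ _)
  congr 1; funext y₀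
  exact PMF.bind_comm _ _ _

end Simulators


/-! ### The view of the receiver from a Diffie–Hellman instance -/

section Receiver

variable {G : GroupGen} {n k : ℕ} {ρ : Bits (G.coinLen n)}

theorem muxC_run_elt (O : Oracle) (c : Bool) (h h' : G.Elt n (G.gen n ρ)) :
    (muxC (G.eltLen n)).run O (c :: (eltBits h ++ eltBits h')) =
      PMF.pure (eltBits (if c then h else h')) := by
  rw [muxC_run _ _ _ _ (by simp) (by simp), ← apply_ite]

theorem muxC_run_bits (O : Oracle) (c : Bool) (u v : Bits k) :
    (muxC k).run O (c :: (List.ofFn u ++ List.ofFn v)) =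
      PMF.pure (List.ofFn (if c then u else v)) := by
  rw [muxC_run _ _ _ _ (by simp) (by simp), ← apply_ite]

theorem xorC_one_run (O : Oracle) (b s : Bool) :
    (xorC 1).run O [b, s] = PMF.pure [xor b s] := by
  simpa [bxor] using xorC_run O (l := 1) (fun _ => b) (fun _ => s)

theorem queryC_run_elt (H : Hash k) (h : G.Elt n (G.gen n ρ)) :
    (queryC (G.eltLen n) k).run H.toOracle (eltBits h) = PMF.pure (List.ofFn (H (eltBits h))) :=
  queryC_run _ _ (by simp) (by simp [Hash.toOracle])

/-- `g ^ x` for the secret exponent `x` of `R`. -/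
def secretElt (s b : Bool) (r₁ r₂ : G.Expo n (G.gen n ρ)) : G.Elt n (G.gen n ρ) :=
  expo (G.g n _) r₂ * (if xor b s then (expo (G.g n _) r₁)⁻¹ else expo (G.g n _) r₁)

/-- The view of `R` in terms of `A = C / g ^ x` and of the half `(Y, u)` of the response that `R`
cannot open; `v` is the output of `R`. -/
def recvView (H : Hash k) (A Y : G.Elt n (G.gen n ρ)) (u : Bits k) (s : Bool) (v : Bits k)
    (b : Bool) (r₁ r₂ y : G.Expo n (G.gen n ρ)) : List Bool :=
  let h := secretElt s b r₁ r₂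
  s :: b :: (expoBits r₁ ++ (expoBits r₂ ++ (List.ofFn (G.gen n ρ) ++ (natToBits n (G.order n (G.gen n ρ)) ++
    (eltBits (G.g n (G.gen n ρ)) ++ (eltBits (A * h) ++
    (eltBits (if s then Y else expo (G.g n _) y) ++
      (List.ofFn (if s then u else bxor (H (eltBits (expo h y))) v) ++
    (eltBits (if s then expo (G.g n _) y else Y) ++
      (List.ofFn (if s then bxor (H (eltBits (expo h y))) v else u) ++ List.ofFn v))))))))))

variable (G) in
/-- A Diffie–Hellman instance `((𝔾, p, g), g ^ a, g ^ b)` together with its solution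
`g ^ (a * b)`. -/
noncomputable def dhChallenge (n : ℕ) : PMF (List Bool × List Bool) :=
  (PMF.uniformOfFintype (Bits (G.coinLen n))).bind fun ρ =>
    (PMF.uniformOfFintype (G.Expo n (G.gen n ρ))).bind fun a =>
    (PMF.uniformOfFintype (G.Expo n (G.gen n ρ))).bind fun b =>
      PMF.pure (G.paramBits n (G.gen n ρ) ++ eltBits (expo (G.g n (G.gen n ρ)) a) ++
          eltBits (expo (G.g n (G.gen n ρ)) b), eltBits (expo (G.g n (G.gen n ρ)) (a * b)))

theorem cdhSuccess_eq (A : Circuit) : G.cdhSuccess A n =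
    (((dhChallenge G n).bind fun z => (A.run noOracle z.1).map fun out => decide (out = z.2))
      true).toReal := by
  simp only [cdhSuccess, dhChallenge, PMF.bind_bind, PMF.pure_bind]

/-- The view of `R` in the protocol, in terms of the exponent `a` of `A = C / g ^ x` and of the
exponent `y'` that `S` draws for the half of the response that `R` cannot open. These are uniform and
independent of the other coins, and that half is masked by the hash of `g ^ (a * y')`. -/
theorem view_R_eq (H : Hash k) (m : Messages k) (s : Bool) :
    ((Coins.dist G n).map fun c => c.view H m s .R) =
      (PMF.uniformOfFintype (Bits (G.coinLen n))).bind fun ρ =>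
      (PMF.uniformOfFintype (G.Expo n (G.gen n ρ))).bind fun a =>
      (PMF.uniformOfFintype (G.Expo n (G.gen n ρ))).bind fun y' =>
      (PMF.uniformOfFintype Bool).bind fun b =>
      (PMF.uniformOfFintype (G.Expo n (G.gen n ρ))).bind fun r₁ =>
      (PMF.uniformOfFintype (G.Expo n (G.gen n ρ))).bind fun r₂ =>
      (PMF.uniformOfFintype (G.Expo n (G.gen n ρ))).bind fun y =>
        PMF.pure (recvView H (expo (G.g n (G.gen n ρ)) a) (expo (G.g n (G.gen n ρ)) y')
          (bxor (H (eltBits (expo (G.g n (G.gen n ρ)) (a * y')))) (m !s)) s (m s) b r₁ r₂ y) := by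
  have hx : ∀ c : Coins G n, expo (G.g n c.desc) (c.x s) = secretElt s c.b c.r₁ c.r₂ := by
    intro c
    unfold Coins.x secretElt Coins.s₂ share
    cases xor c.b s <;> simp [expo_add, expo_neg]
  have hview : ∀ (ρ : Bits (G.coinLen n)) (a : G.Expo n (G.gen n ρ)) (b : Bool)
      (r₁ r₂ : G.Expo n (G.gen n ρ)) (y : Bool → G.Expo n (G.gen n ρ)),
      (⟨ρ, a, b, r₁, r₂, y⟩ : Coins G n).view H m s .R =
      (fun a' => recvView H (expo (G.g n (G.gen n ρ)) a') (expo (G.g n (G.gen n ρ)) (y !s))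
          (bxor (H (eltBits (expo (G.g n (G.gen n ρ)) (a' * y !s)))) (m !s)) s (m s) b r₁ r₂ (y s))
        (a - (r₂ + r₁ * (-1) ^ (xor b s).toNat)) := by
    intro ρ a b r₁ r₂ y
    set c : Coins G n := ⟨ρ, a, b, r₁, r₂, y⟩ with hc
    change _ = (fun a' => recvView H (expo (G.g n (G.gen n ρ)) a') _ _ s _ b r₁ r₂ _) (a - c.x s)
    have h1 : c.β s s = secretElt s b r₁ r₂ := (c.β_self s).trans (hx c)
    have h2 : c.β s (!s) = expo (G.g n (G.gen n ρ)) (a - c.x s) := by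
      rw [expo_sub]; exact c.β_not s
    have h3 : c.C = expo (G.g n (G.gen n ρ)) (a - c.x s) * secretElt s b r₁ r₂ := by
      rw [expo_sub, ← hx c]; exact (div_mul_cancel _ _).symm
    simp only [Coins.view, c.output_eq, c.res_eq, Coins.pkBits, h3, recvView, paramBits]
    rw [expo_mul]
    cases s
    · rw [Bool.not_false] at h2
      simp only [h1, h2, List.append_assoc, List.cons_append, List.nil_append, Bool.not_false,
        Bool.false_eq_true, if_false]
      rfl
    · rw [Bool.not_true] at h2
      simp only [h1, h2, List.append_assoc, List.cons_append, List.nil_append, Bool.not_true,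
        if_true]
      rfl
  rw [Coins.dist_map _ _ hview]
  congr 1; funext ρ
  set U := PMF.uniformOfFintype (G.Expo n (G.gen n ρ)) with hU
  have comm : ∀ f : G.Expo n (G.gen n ρ) → Bool → G.Expo n (G.gen n ρ) → G.Expo n (G.gen n ρ) →
      PMF (List Bool), (U.bind fun a => (PMF.uniformOfFintype Bool).bind fun b => U.bind fun r₁ =>
        U.bind fun r₂ => f a b r₁ r₂) = (PMF.uniformOfFintype Bool).bind fun b => U.bind fun r₁ =>
        U.bind fun r₂ => U.bind fun a => f a b r₁ r₂ := by
    intro f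
    rw [PMF.bind_comm]
    congr 1; funext b
    rw [PMF.bind_comm]
    congr 1; funext r₁
    rw [PMF.bind_comm]
  rw [comm]
  refine Eq.trans ?_ ((congrArg (PMF.bind U) (funext fun a => comm fun y' b r₁ r₂ =>
    U.bind fun y => PMF.pure (recvView H (expo (G.g n (G.gen n ρ)) a)
      (expo (G.g n (G.gen n ρ)) y') (bxor (H (eltBits (expo (G.g n (G.gen n ρ)) (a * y')))) (m !s))
      s (m s) b r₁ r₂ y))).trans (comm _)).symm
  congr 1; funext b
  congr 1; funext r₁
  congr 1; funext r₂
  -- for fixed `b`, `r₁`, `r₂` the exponent of `C` and that of `C / g ^ x` differ by a translation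
  refine (uniformOfFintype_bind_equiv (Equiv.subRight (r₂ + r₁ * (-1) ^ (xor b s).toNat))
    fun a => U.bind fun y₀ => U.bind fun y₁ => PMF.pure (recvView H (expo (G.g n (G.gen n ρ)) a)
      (expo (G.g n (G.gen n ρ)) (if !s then y₁ else y₀))
      (bxor (H (eltBits (expo (G.g n (G.gen n ρ)) (a * if !s then y₁ else y₀)))) (m !s))
      s (m s) b r₁ r₂ (if s then y₁ else y₀))).trans ?_
  congr 1; funext a
  cases s
  · exact PMF.bind_comm _ _ _
  · rfl

variable (G) in
/-- The program that computes the view of `R` from a Diffie–Hellman instance, the mask `u` of the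
half of the response that `R` cannot open, the input of `R` and its output. The blocks `1, …, 8` are
the description, the order, the generator, `A`, `Y`, `u`, `s` and the output; `9, …, 12` are the
coins `b`, `r₁`, `r₂`, `y`; `13` is `s₂`, `18` is `g ^ x`, `19` is `C`, `23` and `22` form the half
of the response that `R` opens, and `24, …, 27` are both halves in the right order. -/
noncomputable def recvF (σ : ℕ → ℕ) : FProg :=
  [([], fun _ => coinsC 1), ([2], belowC), ([2], belowC), ([2], belowC),
    ([9, 7], fun _ => xorC 1), ([1, 3, 10], G.powC), ([1, 3, 11], G.powC), ([1, 14], G.invC),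
    ([13, 16, 14], fun n => muxC (G.eltLen n)), ([1, 15, 17], G.mulC), ([1, 4, 18], G.mulC),
    ([1, 18, 12], G.powC), ([20], fun n => queryC (G.eltLen n) (σ n)),
    ([21, 8], fun n => xorC (σ n)), ([1, 3, 12], G.powC), ([7, 5, 23], fun n => muxC (G.eltLen n)),
    ([7, 6, 22], fun n => muxC (σ n)), ([7, 23, 5], fun n => muxC (G.eltLen n)),
    ([7, 22, 6], fun n => muxC (σ n))]

variable (G) in
/-- The circuits for `recvF`. -/
noncomputable def recvC (σ : ℕ → ℕ) (n : ℕ) : Circuit :=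
  (FProg.at (parseF (fun _ => 0) [G.descLen, fun n => n, G.eltLen, G.eltLen, G.eltLen, σ,
    fun _ => 1, σ] ++ recvF G σ) n).circuit
      (G.descLen n + n + G.eltLen n + G.eltLen n + G.eltLen n + σ n + 1 + σ n)
    [7, 9, 10, 11, 1, 2, 3, 19, 24, 25, 26, 27, 8]

theorem isPPT_recvC {σ : ℕ → ℕ} (hσ : PolyBounded σ) : IsPPT (recvC G σ) := by
  have hE := G.eltLen_poly
  have hD := G.descLen_poly
  refine FProg.isPPT (List.forall_mem_append.2 ⟨isPPT_parseF _ _ ?_, ?_⟩)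
    (.add (.add (.add (.add (.add (.add (.add hD .id) hE) hE) hE) hσ) (.const 1)) hσ)
  · simp only [List.mem_cons, List.not_mem_nil, or_false, forall_eq_or_imp, forall_eq]
    exact ⟨hD, .id, hE, hE, hE, hσ, .const 1, hσ⟩
  · simp only [recvF, List.mem_cons, List.not_mem_nil, or_false, forall_eq_or_imp, forall_eq]
    exact ⟨isPPT_coinsC (.const 1), isPPT_belowC, isPPT_belowC, isPPT_belowC, isPPT_xorC (.const 1),
      G.isPPT_powC, G.isPPT_powC, G.isPPT_invC, isPPT_muxC hE, G.isPPT_mulC, G.isPPT_mulC,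
      G.isPPT_powC, isPPT_queryC hE hσ, isPPT_xorC hσ, G.isPPT_powC, isPPT_muxC hE, isPPT_muxC hσ,
      isPPT_muxC hE, isPPT_muxC hσ⟩

theorem recvC_run {σ : ℕ → ℕ} (hn : 2 ≤ n) (H : Hash (σ n)) (A Y : G.Elt n (G.gen n ρ))
    (u : Bits (σ n)) (s : Bool) (v : Bits (σ n)) :
    (recvC G σ n).run H.toOracle (G.paramBits n (G.gen n ρ) ++ eltBits A ++ eltBits Y ++
      List.ofFn u ++ (s :: List.ofFn v)) =
      (PMF.uniformOfFintype Bool).bind fun b =>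
      (PMF.uniformOfFintype (G.Expo n (G.gen n ρ))).bind fun r₁ =>
      (PMF.uniformOfFintype (G.Expo n (G.gen n ρ))).bind fun r₂ =>
      (PMF.uniformOfFintype (G.Expo n (G.gen n ρ))).bind fun y =>
        PMF.pure (recvView H A Y u s v b r₁ r₂ y) := by
  have hp := FProg.parse_circuit_run H.toOracle (recvF G σ) [G.descLen, fun n => n, G.eltLen,
    G.eltLen, G.eltLen, σ, fun _ => 1, σ] n
    (G.descLen n + n + G.eltLen n + G.eltLen n + G.eltLen n + σ n + 1 + σ n)
    [7, 9, 10, 11, 1, 2, 3, 19, 24, 25, 26, 27, 8]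
    [List.ofFn (G.gen n ρ), natToBits n (G.order n (G.gen n ρ)), eltBits (G.g n (G.gen n ρ)),
      eltBits A, eltBits Y, List.ofFn u, [s], List.ofFn v] (by simp) (by simp; omega)
  have hw : G.paramBits n (G.gen n ρ) ++ eltBits A ++ eltBits Y ++ List.ofFn u ++
      (s :: List.ofFn v) = [List.ofFn (G.gen n ρ), natToBits n (G.order n (G.gen n ρ)),
        eltBits (G.g n (G.gen n ρ)), eltBits A, eltBits Y, List.ofFn u, [s],
        List.ofFn v].flatten := by simp [paramBits]
  rw [recvC, hw, hp, ← hw]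
  simp only [recvF, FProg.at, List.map_cons, List.map_nil, Prog.eval, gather, List.flatMap_cons,
    List.flatMap_nil, List.append_nil, PMF.bind_map, PMF.map_bind, Function.comp_def,
    List.cons_append, List.nil_append, List.getD_cons_succ, List.getD_cons_zero,
    PMF.pure_bind, G.belowC_run _ hn, G.powC_run _ hn, G.mulC_run, G.invC_run, coinsC_one_run,
    xorC_one_run, muxC_run_elt, muxC_run_bits, queryC_run_elt, xorC_run, PMF.pure_map]
  rfl

end Receiver

/-! ### Resampling the random oracle -/

section RandomOracle

variable {k : ℕ}

instance (k : ℕ) : IsProbabilityMeasure (randomOracle k) := by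
  unfold randomOracle; infer_instance

theorem measurable_update_hash (q : List Bool) :
    Measurable fun p : Bits k × Hash k => Function.update p.2 q p.1 := by
  refine measurable_pi_lambda _ fun w => ?_
  by_cases hw : w = q
  · subst hw; simpa using measurable_fst
  · simp only [Function.update_of_ne hw]
    exact (measurable_pi_apply w).comp measurable_snd

/-- Replacing the value at `q` of a random oracle by a fresh uniform value gives a random oracle. -/
theorem randomOracle_map_update (q : List Bool) :
    (((PMF.uniformOfFintype (Bits k)).toMeasure.prod (randomOracle k)).map
      fun p : Bits k × Hash k => Function.update p.2 q p.1) = randomOracle k := by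
  classical
  refine Measure.eq_infinitePi _ fun s t ht => ?_
  rw [Measure.map_apply (measurable_update_hash q)
    (MeasurableSet.pi s.countable_toSet fun i _ => ht i)]
  have hpre : (fun p : Bits k × Hash k => Function.update p.2 q p.1) ⁻¹' (Set.pi ↑s t) =
      (if q ∈ s then t q else Set.univ) ×ˢ Set.pi ↑(s.erase q) t := by
    ext ⟨u, H⟩
    simp only [Set.mem_preimage, Set.mem_pi, Finset.mem_coe, Set.mem_prod, Finset.mem_erase]
    constructor
    · intro h
      refine ⟨?_, fun i hi => by simpa [Function.update_of_ne hi.1] using h i hi.2⟩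
      split_ifs with hq
      · simpa using h q hq
      · trivial
    · rintro ⟨h1, h2⟩ i hi
      by_cases hiq : i = q
      · subst hiq; simpa [hi] using h1
      · simpa [Function.update_of_ne hiq] using h2 i ⟨hiq, hi⟩
  rw [hpre, Measure.prod_prod, randomOracle, Measure.infinitePi_pi _ fun i _ => ht i]
  split_ifs with hq
  · exact Finset.mul_prod_erase s (fun i => (PMF.uniformOfFintype (Bits k)).toMeasure (t i)) hq
  · rw [Finset.erase_eq_of_notMem hq]; simp

theorem lintegral_randomOracle_update {f : Hash k → ENNReal} (hf : Measurable f) (q : List Bool) :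
    ∫⁻ H, f H ∂randomOracle k = ∑' u, PMF.uniformOfFintype (Bits k) u *
      ∫⁻ H, f (Function.update H q u) ∂randomOracle k := by
  conv_lhs => rw [← randomOracle_map_update q]
  rw [lintegral_map hf (measurable_update_hash q),
    lintegral_prod (fun p : Bits k × Hash k => f (Function.update p.2 q p.1))
      (hf.comp (measurable_update_hash q)).aemeasurable, lintegral_fintype, tsum_fintype]
  refine Finset.sum_congr rfl fun u _ => ?_
  rw [PMF.toMeasure_apply_singleton _ _ (measurableSet_singleton u), mul_comm]

/-! ### Measurability -/

theorem measurable_bind {α β : Type*} [Countable α] (p : PMF α) {X : Hash k → α → PMF β} (v : β)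
    (h : ∀ a, Measurable fun H => X H a v) : Measurable fun H => (p.bind (X H)) v := by
  simp only [PMF.bind_apply]
  exact Measurable.tsum fun a => (h a).const_mul _

theorem lintegral_bind {α β : Type*} [Countable α] (p : PMF α) {X : Hash k → α → PMF β} (v : β)
    (h : ∀ a, Measurable fun H => X H a v) :
    ∫⁻ H, (p.bind (X H)) v ∂randomOracle k = ∑' a, p a * ∫⁻ H, X H a v ∂randomOracle k := by
  simp only [PMF.bind_apply]
  rw [lintegral_tsum fun a => ((h a).const_mul _).aemeasurable]
  exact tsum_congr fun a => lintegral_const_mul _ (h a)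

/-- As a hash value ranges over a finite set, measurability may be checked for each fixed value. -/
theorem measurable_eval_hash {f : Bits k → Hash k → ENNReal} (h : ∀ u, Measurable (f u))
    (q : List Bool) : Measurable fun H : Hash k => f (H q) H := by
  have h1 : Measurable fun p : Bits k × Hash k => f p.1 p.2 :=
    measurable_from_prod_countable_right h
  have h2 : Measurable fun H : Hash k => (H q, H) :=
    Measurable.prodMk (measurable_pi_apply q) measurable_id
  exact h1.comp h2

theorem measurable_runGates {β : Type*} (es : List Gate) (M : Memory) (f : Memory → β) (v : β) :
    Measurable fun H : Hash k => ((runGates H.toOracle es M).map f) v := by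
  induction es generalizing M with
  | nil => simp only [runGates]; exact measurable_const
  | cons e es ih =>
    cases e with
    | const r b => simpa only [runGates, Gate.step, PMF.pure_bind] using ih _
    | nand r a b => simpa only [runGates, Gate.step, PMF.pure_bind] using ih _
    | sample dst src =>
      simp only [runGates, Gate.step, PMF.bind_map, PMF.map_bind]
      exact measurable_bind _ _ fun x => ih _
    | query dst src =>
      simp only [runGates, Gate.step, PMF.pure_bind]
      exact measurable_eval_hash (f := fun u H => ((runGates H.toOracle es
        (M.write dst (List.ofFn u))).map f) v) (fun u => ih _) (src.map M)

theorem measurable_run (A : Circuit) (w v : List Bool) :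
    Measurable fun H : Hash k => A.run H.toOracle w v :=
  measurable_runGates _ _ _ _

/-! ### Lazy sampling of the random oracle -/

/-- The hash function `H`, overridden by a table of values. -/
def override (tab : List (List Bool × Bits k)) (H : Hash k) : Hash k := fun q =>
  (tab.lookup q).getD (H q)

theorem override_nil (H : Hash k) : override [] H = H := rfl

theorem override_cons_of_lookup_eq_some {tab : List (List Bool × Bits k)} {q : List Bool}
    {u : Bits k} (h : tab.lookup q = some u) (H : Hash k) :
    override ((q, u) :: tab) H = override tab H := by
  funext w
  by_cases hw : w = q
  · subst hw; simp [override, h]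
  · have : (w == q) = false := by simpa using hw
    simp [override, List.lookup_cons, this]

theorem override_update_of_lookup_eq_none {tab : List (List Bool × Bits k)} {q : List Bool}
    (h : tab.lookup q = none) (u : Bits k) (H : Hash k) :
    override tab (Function.update H q u) = override ((q, u) :: tab) H := by
  funext w
  by_cases hw : w = q
  · subst hw; simp [override, h]
  · have : (w == q) = false := by simpa using hw
    simp [override, List.lookup_cons, this, Function.update_of_ne hw]

theorem measurable_override (tab : List (List Bool × Bits k)) : Measurable (override tab) := by
  refine measurable_pi_lambda _ fun q => ?_
  simp only [override]
  cases tab.lookup q with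
  | none => exact measurable_pi_apply q
  | some u => exact measurable_const

/-- Execution of gates with a random oracle whose values are drawn when they are first queried;
`tab` holds the values drawn so far. -/
noncomputable def lazyRun : List (List Bool × Bits k) → List Gate → Memory → PMF Memory
  | _, [], M => PMF.pure M
  | tab, .const r b :: es, M => lazyRun tab es (Function.update M r b)
  | tab, .nand r a b :: es, M => lazyRun tab es (Function.update M r (!(M a && M b)))
  | tab, .sample dst src :: es, M =>
      (uniformBelow (bitsToNat (src.map M))).bind fun x =>
        lazyRun tab es (M.write dst (natToBits dst.length x))
  | tab, .query dst src :: es, M =>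
      (PMF.uniformOfFintype (Bits k)).bind fun u =>
        lazyRun ((src.map M, (tab.lookup (src.map M)).getD u) :: tab) es
          (M.write dst (List.ofFn ((tab.lookup (src.map M)).getD u)))

/-- Lazy sampling does not change the output distribution: the value at a new query is resampled, and
from then on it is an entry of the table. -/
theorem lintegral_runGates_override {β : Type*} (tab : List (List Bool × Bits k)) (es : List Gate)
    (M : Memory) (f : Memory → β) (v : β) :
    ∫⁻ H, ((runGates (override tab H).toOracle es M).map f) v ∂randomOracle k =
      ((lazyRun tab es M).map f) v := by
  have hmeas : ∀ (tab : List (List Bool × Bits k)) es M, Measurable fun H : Hash k =>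
      ((runGates (override tab H).toOracle es M).map f) v := fun tab es M =>
    (measurable_runGates es M f v).comp (measurable_override tab)
  induction es generalizing tab M with
  | nil => simp [runGates, lazyRun]
  | cons e es ih =>
    cases e with
    | const r b => simpa only [runGates, Gate.step, PMF.pure_bind, lazyRun] using ih _ _
    | nand r a b => simpa only [runGates, Gate.step, PMF.pure_bind, lazyRun] using ih _ _
    | sample dst src =>
      simp only [runGates, Gate.step, PMF.bind_map, PMF.map_bind, lazyRun,
        Function.comp_apply]
      rw [lintegral_bind _ _ fun x => hmeas _ _ _, PMF.bind_apply]
      exact tsum_congr fun x => by rw [← ih]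
    | query dst src =>
      simp only [runGates, Gate.step, PMF.pure_bind, lazyRun, PMF.map_bind]
      cases hq : tab.lookup (src.map M) with
      | some u =>
        simp only [Option.getD_some, PMF.bind_const]
        rw [← ih]
        simp only [override_cons_of_lookup_eq_some hq, Hash.toOracle]
        simp only [override, hq, Option.getD_some]
      | none =>
        simp only [Option.getD_none]
        rw [lintegral_randomOracle_update (q := src.map M), PMF.bind_apply]
        · refine tsum_congr fun u => ?_
          rw [← ih]
          simp only [override_update_of_lookup_eq_none hq]
          simp only [Hash.toOracle, override, List.lookup_cons_self, Option.getD_some]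
        · have := measurable_eval_hash (k := k) (f := fun u H =>
            ((runGates H.toOracle es (M.write dst (List.ofFn u))).map f) v)
            (fun u => measurable_runGates _ _ _ _) (src.map M)
          exact this.comp (measurable_override tab)

/-! ### Reprogramming the oracle at one point -/

/-- The registers that a gate sends to the oracle. -/
def Gate.querySrc : Gate → List ℕ
  | .query _ src => src
  | _ => []

open Classical in
/-- An upper bound for the probability that `T` is queried: the expected number of gates that send
`T` to the oracle (where other gates count as gates that send the empty string). -/
noncomputable def queryProb (O : Oracle) (T : List Bool) : List Gate → Memory → ENNReal
  | [], _ => 0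
  | e :: es, M => (if T = e.querySrc.map M then 1 else 0) +
      ∑' M', e.step O M M' * queryProb O T es M'

/-- `queryProb` as a sum over the gates: a gate contributes the probability that the execution of the
preceding gates leaves `T` in the registers that it sends to the oracle. -/
theorem queryProb_eq_sum (O : Oracle) (T : List Bool) (es : List Gate) (M : Memory) :
    queryProb O T es M = ∑ j : Fin es.length,
      ((runGates O (es.take j) M).map fun M' => es[j].querySrc.map M') T := by
  induction es generalizing M with
  | nil => simp [queryProb]
  | cons e es ih =>
    have h := Fin.sum_univ_succ fun j : Fin (es.length + 1) =>
      ((runGates O ((e :: es).take j) M).map fun M' => (e :: es)[j].querySrc.map M') T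
    refine Eq.trans ?_ h.symm
    rw [queryProb]
    congr 1
    · simp [runGates, PMF.pure_map, PMF.pure_apply]
    · simp only [Fin.val_succ, List.take_succ_cons, runGates, PMF.map_bind, PMF.bind_apply, ih]
      rw [← Summable.tsum_finsetSum fun _ _ => ENNReal.summable]
      exact tsum_congr fun M' => Finset.mul_sum _ _ _

/-- Executions with two oracles that agree except at `T` have the same distribution up to the
probability that `T` is queried. In both inequalities this is the probability for the same
oracle. -/
theorem runGates_le_add_queryProb {O O' : Oracle} {T : List Bool} (h : ∀ w, w ≠ T → O w = O' w)
    {β : Type*} (es : List Gate) (M : Memory) (f : Memory → β) (v : β) :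
    ((runGates O es M).map f) v ≤ ((runGates O' es M).map f) v + queryProb O T es M ∧
      ((runGates O' es M).map f) v ≤ ((runGates O es M).map f) v + queryProb O T es M := by
  classical
  induction es generalizing M with
  | nil => simp [runGates]
  | cons e es ih =>
    by_cases hT : T = e.querySrc.map M
    · have h1 : 1 ≤ queryProb O T (e :: es) M := by
        rw [queryProb, if_pos hT]; exact le_self_add
      exact ⟨(PMF.coe_le_one _ _).trans (h1.trans le_add_self),
        (PMF.coe_le_one _ _).trans (h1.trans le_add_self)⟩
    · have hstep : e.step O M = e.step O' M := by
        cases e with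
        | query dst src => simp only [Gate.step, h (src.map M) (Ne.symm hT)]
        | _ => rfl
      simp only [runGates, PMF.map_bind, PMF.bind_apply, queryProb, if_neg hT, zero_add, ← hstep]
      rw [← ENNReal.tsum_add, ← ENNReal.tsum_add]
      constructor <;> refine ENNReal.tsum_le_tsum fun M' => ?_ <;> rw [← mul_add]
      · exact mul_le_mul_right (ih M').1 _
      · exact mul_le_mul_right (ih M').2 _

end RandomOracle

/-! ### Circuits that sample the random oracle themselves -/

section Lazy

/-- The formula for the equality of the contents of two lists of registers. -/
def eqForm : List ℕ → List ℕ → BExp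
  | [], [] => .const true
  | a :: as, b :: bs => ((BExp.var a).xor (.var b)).not.and (eqForm as bs)
  | _, _ => .const false

theorem eqForm_eval (M : Memory) (as bs : List ℕ) :
    (eqForm as bs).eval M = decide (as.map M = bs.map M) := by
  induction as generalizing bs with
  | nil => cases bs <;> simp [eqForm, BExp.eval]
  | cons a as ih =>
    cases bs with
    | nil => simp [eqForm, BExp.eval]
    | cons b bs =>
      simp only [eqForm, BExp.eval_and, BExp.eval_not, BExp.eval_xor, ih, BExp.eval, List.map_cons,
        List.cons.injEq]
      cases M a <;> cases M b <;> simp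

theorem eqForm_cost (as bs : List ℕ) : (eqForm as bs).cost ≤ 2 + 100 * as.length := by
  induction as generalizing bs with
  | nil => cases bs <;> simp [eqForm, BExp.cost]
  | cons a as ih =>
    cases bs with
    | nil => simp [eqForm, BExp.cost]
    | cons b bs =>
      have := ih bs
      simp only [eqForm, BExp.cost, BExp.and, BExp.not, BExp.xor, List.length_cons]
      omega

theorem eqForm_bound {as bs : List ℕ} {t : ℕ} (ha : ∀ r ∈ as, r < t) (hb : ∀ r ∈ bs, r < t) :
    (eqForm as bs).bound ≤ t := by
  induction as generalizing bs with
  | nil => cases bs <;> simp [eqForm, BExp.bound]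
  | cons a as ih =>
    cases bs with
    | nil => simp [eqForm, BExp.bound]
    | cons b bs =>
      simp only [List.mem_cons, forall_eq_or_imp] at ha hb
      have := ih ha.2 hb.2
      simp only [eqForm, BExp.bound, BExp.and, BExp.not, BExp.xor]
      omega

/-- The formula for bit `i` of the answer to the query in the registers `S`: look the query up in
the table of former queries and answers, and if this fails use the default bit in register `d`. -/
def answerForm (S : List ℕ) (d i : ℕ) : List (List ℕ × List ℕ) → BExp
  | [] => .var d
  | e :: table => (eqForm S e.1).mux (.var (e.2.getD i 0)) (answerForm S d i table)

theorem answerForm_cost (S : List ℕ) (d i : ℕ) (table : List (List ℕ × List ℕ)) :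
    (answerForm S d i table).cost ≤ 8 + table.length * (50 + 200 * S.length) := by
  induction table with
  | nil => simp [answerForm, BExp.cost]
  | cons e table ih =>
    have := eqForm_cost S e.1
    simp only [answerForm, BExp.mux, BExp.not, BExp.cost, List.length_cons, Nat.add_mul, one_mul]
    omega

variable {k : ℕ}

/-- An entry of a table of registers holds an entry of the semantic table; its registers lie between
`t₀` and `t`. -/
def Holds (t₀ t : ℕ) (M : Memory) (e : List ℕ × List ℕ) (x : List Bool × Bits k) : Prop :=
  (∀ r ∈ e.1 ++ e.2, t₀ ≤ r ∧ r < t) ∧ e.1.map M = x.1 ∧ e.2.map M = List.ofFn x.2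

theorem Holds.mono {t₀ t t' : ℕ} {M M' : Memory} (ht : t ≤ t')
    (hM : ∀ r, t₀ ≤ r → r < t → M' r = M r) {e : List ℕ × List ℕ} {x : List Bool × Bits k}
    (h : Holds t₀ t M e x) : Holds t₀ t' M' e x := by
  obtain ⟨h1, h2, h3⟩ := h
  refine ⟨fun r hr => ⟨(h1 r hr).1, (h1 r hr).2.trans_le ht⟩, ?_, ?_⟩
  · rw [← h2]
    refine List.map_congr_left fun r hr => ?_
    have := h1 r (List.mem_append_left _ hr)
    exact hM r this.1 this.2
  · rw [← h3]
    refine List.map_congr_left fun r hr => ?_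
    have := h1 r (List.mem_append_right _ hr)
    exact hM r this.1 this.2

/-- The formula computes a bit of the answer that `lazyRun` gives. -/
theorem answerForm_eval {t₀ t : ℕ} {M : Memory} {table : List (List ℕ × List ℕ)}
    {tab : List (List Bool × Bits k)} (h : List.Forall₂ (Holds t₀ t M) table tab) (S : List ℕ)
    (d : ℕ) (i : Fin k) (u : Bits k) (hd : M d = u i) :
    (answerForm S d i table).eval M = ((tab.lookup (S.map M)).getD u) i := by
  induction h with
  | nil => simpa [answerForm, BExp.eval] using hd
  | @cons e x table tab hex _ ih =>
    obtain ⟨-, h2, h3⟩ := hex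
    have hlen : e.2.length = k := by simpa using congrArg List.length h3
    have hi : (i : ℕ) < e.2.length := by omega
    have h4 : M (e.2.getD i 0) = x.2 i := by
      have := congrArg (fun l => l[(i : ℕ)]?) h3
      simpa [hi] using this
    simp only [answerForm, BExp.eval_mux, eqForm_eval, h2, ih, BExp.eval, h4, decide_eq_true_eq]
    obtain ⟨x1, x2⟩ := x
    rw [List.lookup_cons]
    by_cases hS : S.map M = x1
    · simp [hS]
    · have : (S.map M == x1) = false := by simpa using hS
      simp [hS, this]

theorem answerForm_bound {t₀ t t' : ℕ} {M : Memory} {table : List (List ℕ × List ℕ)}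
    {tab : List (List Bool × Bits k)} (h : List.Forall₂ (Holds t₀ t M) table tab) {S : List ℕ}
    {d i : ℕ} (hi : i < k) (hS : ∀ r ∈ S, r < t') (hd : d < t') (ht : t ≤ t') :
    (answerForm S d i table).bound ≤ t' := by
  induction h with
  | nil => simpa [answerForm, BExp.bound] using hd
  | @cons e x table tab hex _ ih =>
    obtain ⟨h1, h2, h3⟩ := hex
    have hlen : e.2.length = k := by simpa using congrArg List.length h3
    have hi' : i < e.2.length := by omega
    have h4 := eqForm_bound hS (bs := e.1) fun r hr =>
      (h1 r (List.mem_append_left _ hr)).2.trans_le ht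
    have h5 : e.2.getD i 0 < t' := by
      have := (h1 e.2[i] (List.mem_append_right _ (List.getElem_mem hi'))).2
      rw [List.getD_eq_getElem _ _ hi']
      omega
    simp only [answerForm, BExp.mux, BExp.not, BExp.bound]
    omega

/-- Replace the oracle queries of a list of gates by lazy sampling. The registers from `t` on are
free, and the registers of former queries and answers are listed in `table`. -/
def lazyGates (k : ℕ) : List Gate → ℕ → List (List ℕ × List ℕ) → List Gate
  | [], _, _ => []
  | .query dst src :: es, t, table =>
    let S := List.range' t src.length
    let d := t + src.length
    let t' := d + k + 2
    copyGates S src ++ (coinGates (List.range' d k) (d + k) ++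
      (formGates ((List.range k).map fun i => answerForm S (d + i) i table) t' ++
        (copyGates dst (List.range' t' k) ++
          lazyGates k es (t' + k) ((S, List.range' t' k) :: table))))
  | e :: es, t, table => e :: lazyGates k es t table

theorem runGates_coinGates_of_length_eq (O : Oracle) {dst : List ℕ} (hk : dst.length = k) (z : ℕ) (M : Memory) :
    ∃ M' : Memory, (∀ r, r ≠ z → r ≠ z + 1 → M' r = M r) ∧ runGates O (coinGates dst z) M =
      (PMF.uniformOfFintype (Bits k)).map fun u => M'.write dst (List.ofFn u) := by
  subst hk
  exact runGates_coinGates O dst z M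

/-- The gates `lazyGates` implement `lazyRun` on the registers below `t₀`. -/
theorem runGates_lazyGates {t₀ : ℕ} {out : List ℕ} (hout : ∀ r ∈ out, r < t₀) (es : List Gate)
    (hes : ∀ e ∈ es, ∀ r ∈ e.regs, r < t₀) (t : ℕ) (ht : t₀ ≤ t)
    (table : List (List ℕ × List ℕ)) (tab : List (List Bool × Bits k)) (M N : Memory)
    (hMN : ∀ r < t₀, M r = N r) (htab : List.Forall₂ (Holds t₀ t M) table tab) :
    (runGates noOracle (lazyGates k es t table) M).map (fun M' => out.map M') =
      (lazyRun tab es N).map fun M' => out.map M' := by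
  induction es generalizing t table tab M N with
  | nil =>
    simp only [lazyGates, runGates, lazyRun, PMF.pure_map]
    congr 1
    exact List.map_congr_left fun r hr => hMN r (hout r hr)
  | cons e es ih =>
    simp only [List.mem_cons, forall_eq_or_imp] at hes
    obtain ⟨he, hes⟩ := hes
    cases e with
    | const r b =>
      have hr : r < t₀ := he r (by simp [Gate.regs])
      simp only [lazyGates, runGates, Gate.step, PMF.pure_bind, lazyRun]
      refine ih hes t ht table tab _ _ (fun q hq => ?_) (htab.imp fun _ _ h =>
        h.mono le_rfl fun q hq _ => Function.update_of_ne (by omega) _ _)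
      by_cases hqr : q = r
      · subst hqr; simp
      · simpa [Function.update_of_ne hqr] using hMN q hq
    | nand r a b =>
      have hr : r < t₀ := he r (by simp [Gate.regs])
      have ha : a < t₀ := he a (by simp [Gate.regs])
      have hb : b < t₀ := he b (by simp [Gate.regs])
      simp only [lazyGates, runGates, Gate.step, PMF.pure_bind, lazyRun]
      refine ih hes t ht table tab _ _ (fun q hq => ?_) (htab.imp fun _ _ h =>
        h.mono le_rfl fun q hq _ => Function.update_of_ne (by omega) _ _)
      by_cases hqr : q = r
      · subst hqr; simp [hMN a ha, hMN b hb]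
      · simpa [Function.update_of_ne hqr] using hMN q hq
    | sample dst src =>
      have hdst : ∀ r ∈ dst, r < t₀ := fun r hr => he r (by simp [Gate.regs, hr])
      have hsrc : src.map M = src.map N :=
        List.map_congr_left fun r hr => hMN r (he r (by simp [Gate.regs, hr]))
      simp only [lazyGates, runGates, Gate.step, lazyRun, PMF.bind_map, PMF.map_bind, hsrc]
      congr 1
      funext x
      exact ih hes t ht table tab _ _ (fun q hq => Memory.write_congr (hMN q hq) _ _)
        (htab.imp fun _ _ h => h.mono le_rfl fun q hq _ =>
          Memory.write_of_notMem (fun hmem => absurd (hdst q hmem) (by omega)) _ _)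
    | query dst src =>
      have hdst : ∀ r ∈ dst, r < t₀ := fun r hr => he r (by simp [Gate.regs, hr])
      have hsrc' : ∀ r ∈ src, r < t₀ := fun r hr => he r (by simp [Gate.regs, hr])
      have hsrc : src.map M = src.map N := List.map_congr_left fun r hr => hMN r (hsrc' r hr)
      simp only [lazyGates, lazyRun]
      set S := List.range' t src.length with hS
      set d := t + src.length with hd
      have hSmem : ∀ r, r ∈ S ↔ t ≤ r ∧ r < d := fun r => by rw [hS, List.mem_range'_1]
      have hRmem : ∀ r, r ∈ List.range' d k ↔ d ≤ r ∧ r < d + k :=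
        fun r => by rw [List.mem_range'_1]
      have hAmem : ∀ r, r ∈ List.range' (d + k + 2) k ↔ d + k + 2 ≤ r ∧ r < d + k + 2 + k :=
        fun r => by rw [List.mem_range'_1]
      rw [runGates_append, runGates_copyGates _ _ _ fun r hr hr' => by
        have := hsrc' r hr; rw [hSmem] at hr'; omega, PMF.pure_bind]
      -- `M1`: the query is saved in the registers `S`
      set M1 := M.write S (src.map M) with hM1
      have hM1S : S.map M1 = src.map N := by
        rw [← hsrc]; exact Memory.map_write List.nodup_range' _ (by simp)
      have hM1r : ∀ r < t, M1 r = M r := fun r hr =>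
        Memory.write_of_notMem (fun h => by rw [hSmem] at h; omega) _ _
      obtain ⟨M2, hM2, hcoin⟩ := runGates_coinGates_of_length_eq (k := k) noOracle
        (dst := List.range' d k) (by simp) (d + k) M1
      rw [runGates_append, hcoin, PMF.bind_map, PMF.map_bind, PMF.map_bind]
      congr 1
      funext u
      simp only [Function.comp_apply]
      -- `M3`: fresh bits `u` are drawn, to be used if the query is new
      set M3 := M2.write (List.range' d k) (List.ofFn u) with hM3
      have hM3r : ∀ r < d, M3 r = M1 r := fun r hr => by
        rw [hM3, Memory.write_of_notMem (fun h => by rw [hRmem] at h; omega),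
          hM2 r (by omega) (by omega)]
      have hM3S : S.map M3 = src.map N := by
        rw [← hM1S]
        exact List.map_congr_left fun r hr => hM3r r ((hSmem r).1 hr).2
      have hM3R : (List.range' d k).map M3 = List.ofFn u :=
        Memory.map_write List.nodup_range' _ (by simp)
      have htab3 : List.Forall₂ (Holds t₀ t M3) table tab := htab.imp fun _ _ h =>
        h.mono le_rfl fun q _ hq => by rw [hM3r q (by omega), hM1r q hq]
      -- `M4`: the answer is determined, from the table or from `u`
      obtain ⟨M4, hM4, hM4A, hM4r⟩ := runGates_formGates noOracle
        ((List.range k).map fun i => answerForm S (d + i) i table) (d + k + 2) M3 (by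
          intro e he
          obtain ⟨i, hi, rfl⟩ := List.mem_map.1 he
          rw [List.mem_range] at hi
          exact answerForm_bound htab3 hi (fun r hr => by rw [hSmem] at hr; omega) (by omega)
            (by omega))
      set a := (tab.lookup (src.map N)).getD u with ha
      have hM4A' : (List.range' (d + k + 2) k).map M4 = List.ofFn a := by
        simp only [List.length_map, List.length_range] at hM4A
        rw [hM4A, List.map_map]
        apply List.ext_getElem
        · simp
        · intro i h1 h2
          have hi : i < k := by simpa using h1
          have hu : M3 (d + i) = u ⟨i, hi⟩ := by
            have := congrArg (fun l => l[i]?) hM3R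
            simpa [hi] using this
          have := answerForm_eval htab3 S (d + i) ⟨i, hi⟩ u hu
          simpa [hM3S, ← ha] using this
      rw [runGates_append, hM4, PMF.pure_bind, runGates_append,
        runGates_copyGates _ _ _ fun r hr hr' => by
          have := hdst r hr'; rw [hAmem] at hr; omega, PMF.pure_bind, hM4A']
      have hM5 : ∀ r, t₀ ≤ r → M4.write dst (List.ofFn a) r = M4 r := fun r hr =>
        Memory.write_of_notMem (fun h => absurd (hdst r h) (by omega)) _ _
      refine ih hes (d + k + 2 + k) (by omega) _ _ _ _ (fun r hr => ?_) (.cons ⟨?_, ?_, ?_⟩ ?_)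
      · refine Memory.write_congr ?_ _ _
        rw [hM4r r (by omega), hM3r r (by omega), hM1r r (by omega), hMN r hr]
      · intro r hr
        rcases List.mem_append.1 hr with hr | hr
        · rw [hSmem] at hr; omega
        · rw [hAmem] at hr; omega
      · rw [← hM3S]
        refine List.map_congr_left fun r hr => ?_
        have := (hSmem r).1 hr
        rw [hM5 r (by omega), hM4r r (by omega)]
      · refine Eq.trans (List.map_congr_left fun r hr => ?_) hM4A'
        have := (hAmem r).1 hr
        exact hM5 r (by omega)
      · exact htab3.imp fun _ _ h => h.mono (by omega) fun q hq hq' => by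
          rw [hM5 q hq, hM4r q (by omega)]

/-- A bound for the cost of the lazy sampling of one query, in programs of size `Z`. -/
def lazyCost (k Z : ℕ) : ℕ := 8 * Z + (2 * k + 6) + k * (8 + Z * (50 + 200 * Z)) + 8 * k

theorem gatesSize_lazyGates_le (es : List Gate) (t : ℕ) (table : List (List ℕ × List ℕ)) (Z : ℕ)
    (h1 : gatesSize es ≤ Z) (h2 : table.length + es.length ≤ Z) :
    gatesSize (lazyGates k es t table) ≤ gatesSize es + es.length * lazyCost k Z := by
  induction es generalizing t table with
  | nil => simp [lazyGates]
  | cons e es ih =>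
    simp only [gatesSize_cons, List.length_cons] at h1 h2
    cases e with
    | query dst src =>
      have h3 := ih (t + src.length + k + 2 + k) ((List.range' t src.length,
        List.range' (t + src.length + k + 2) k) :: table) (by omega) (by simp; omega)
      have h4 : src.length ≤ Z := by simp only [Gate.size] at h1; omega
      have h5 := gatesSize_copyGates (List.range' t src.length) src
      have h6 := gatesSize_copyGates dst (List.range' (t + src.length + k + 2) k)
      have h7 : (((List.range k).map fun i => answerForm (List.range' t src.length)
          (t + src.length + i) i table).map BExp.cost).sum ≤ k * (8 + Z * (50 + 200 * Z)) := by
        have := List.sum_le_card_nsmul (((List.range k).map fun i =>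
          answerForm (List.range' t src.length) (t + src.length + i) i table).map BExp.cost)
          (8 + Z * (50 + 200 * Z)) (by
            intro c hc
            simp only [List.map_map, List.mem_map, Function.comp_apply] at hc
            obtain ⟨i, -, rfl⟩ := hc
            refine (answerForm_cost _ _ _ _).trans ?_
            rw [List.length_range']
            exact Nat.add_le_add_left (Nat.mul_le_mul (by omega) (by omega)) _)
        simpa using this
      have h8 : gatesSize (coinGates (List.range' (t + src.length) k) (t + src.length + k)) =
          2 * k + 6 := by
        simp [coinGates, Gate.size]; omega
      simp only [lazyGates, gatesSize_append, gatesSize_formGates, h8, gatesSize_cons,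
        List.length_cons, Nat.add_mul, one_mul, List.length_range'] at h3 h6 ⊢
      rw [lazyCost] at h3 ⊢
      omega
    | const r b =>
      have := ih t table (by omega) (by omega)
      simp only [lazyGates, gatesSize_cons, List.length_cons, Nat.add_mul, one_mul]
      omega
    | nand r a b =>
      have := ih t table (by omega) (by omega)
      simp only [lazyGates, gatesSize_cons, List.length_cons, Nat.add_mul, one_mul]
      omega
    | sample dst src =>
      have := ih t table (by omega) (by omega)
      simp only [lazyGates, gatesSize_cons, List.length_cons, Nat.add_mul, one_mul]
      omega

/-- The circuit that executes gates with a lazily sampled random oracle and outputs the registers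
listed in `out`. -/
def lazyC (k : ℕ) (es : List Gate) (out : List ℕ) : Circuit :=
  let t₀ := regsBound es + out.sum + 1
  let m := out.length
  { gates := lazyGates k es t₀ [] ++ (copyGates (List.range' (t₀ + m) m) out ++
      copyGates (List.range m) (List.range' (t₀ + m) m))
    outLen := m }

theorem lazyC_run (es : List Gate) (out : List ℕ) (w v : List Bool) :
    (lazyC k es out).run noOracle w v =
      ∫⁻ H : Hash k, ((runGates H.toOracle es (Memory.load w)).map fun M => out.map M) v
        ∂randomOracle k := by
  have h1 := lintegral_runGates_override (k := k) [] es (Memory.load w) (fun M => out.map M) v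
  simp only [override_nil] at h1
  have hout : ∀ r ∈ out, r < regsBound es + out.sum + 1 := fun r hr => by
    have := List.le_sum_of_mem hr; omega
  have h2 := runGates_lazyGates (k := k) hout es
    (fun e he r hr => by have := lt_regsBound he hr; omega) _ le_rfl [] [] (Memory.load w)
    (Memory.load w) (fun _ _ => rfl) .nil
  rw [h1, ← h2]
  congr 1
  simp only [lazyC, Circuit.run]
  rw [runGates_append, PMF.map_bind, ← PMF.bind_pure_comp]
  congr 1
  funext M
  rw [runGates_append, runGates_copyGates _ _ _ (fun r hr hr' => by
      have := hout r hr; rw [List.mem_range'_1] at hr'; omega), PMF.pure_bind,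
    runGates_copyGates _ _ _ (fun r hr hr' => by
      rw [List.mem_range'_1] at hr; rw [List.mem_range] at hr'; omega), PMF.pure_map,
    Memory.map_write List.nodup_range' _ (by simp), Memory.map_write List.nodup_range _ (by simp)]
  rfl

theorem length_le_gatesSize (es : List Gate) : es.length ≤ gatesSize es := by
  induction es with
  | nil => simp
  | cons e es ih =>
    have : 1 ≤ e.size := by cases e <;> simp [Gate.size] <;> omega
    simp only [List.length_cons, gatesSize_cons]
    omega

theorem lazyC_size_le (es : List Gate) (out : List ℕ) (Z : ℕ) (h : gatesSize es ≤ Z)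
    (ho : out.length ≤ Z) : (lazyC k es out).size ≤ 18 * Z + Z * lazyCost k Z := by
  have h1 := length_le_gatesSize es
  have h2 := gatesSize_lazyGates_le (k := k) es (regsBound es + out.sum + 1) [] Z h
    (by simp; omega)
  have h3 := gatesSize_copyGates
    (List.range' (regsBound es + out.sum + 1 + out.length) out.length) out
  have h4 := gatesSize_copyGates (List.range out.length)
    (List.range' (regsBound es + out.sum + 1 + out.length) out.length)
  have h5 : es.length * lazyCost k Z ≤ Z * lazyCost k Z := Nat.mul_le_mul_right _ (by omega)
  rw [Circuit.size_eq]
  simp only [lazyC, gatesSize_append, List.length_range'] at h4 ⊢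
  omega

end Lazy


/-! ### Replacing the hash value at the Diffie–Hellman solution by a random string -/

section Hybrid

variable {k : ℕ}

/-- Translation of bit strings. -/
def bxorEquiv (v : Bits k) : Bits k ≃ Bits k where
  toFun u := bxor u v
  invFun u := bxor u v
  left_inv u := by funext i; simp [bxor]
  right_inv u := by funext i; simp [bxor]

/-- A search algorithm obtained from a circuit `E` with access to a random oracle. On input `z` of
length `ℓ` it runs `E` on `z`, a random `k`-bit string, and `tail`, with a lazily sampled random
oracle, up to gate `j`, and outputs what this gate sends to the oracle. -/
def attackC (k ℓ : ℕ) (tail : List Bool) (E : Circuit) (j : Fin E.gates.length) : Circuit :=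
  Prog.circuit [([], coinsC k), ([], constC tail),
    ([0, 1, 2], lazyC k (E.gates.take j) E.gates[j].querySrc)] ℓ [3]

theorem attackC_run {ℓ : ℕ} (tail : List Bool) (E : Circuit) (j : Fin E.gates.length)
    {z : List Bool} (hz : z.length = ℓ) (v : List Bool) :
    (attackC k ℓ tail E j).run noOracle z v = ∑' u, PMF.uniformOfFintype (Bits k) u *
      ∫⁻ H : Hash k, ((runGates H.toOracle (E.gates.take j)
        (Memory.load (z ++ List.ofFn u ++ tail))).map fun M => E.gates[j].querySrc.map M) v
          ∂randomOracle k := by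
  rw [attackC, Prog.circuit_run _ _ _ _ hz]
  simp only [Prog.eval, gather, List.flatMap_cons, List.flatMap_nil, List.append_nil, PMF.bind_map,
    PMF.map_bind, Function.comp_def, List.cons_append, List.nil_append, List.getD_cons_succ,
    List.getD_cons_zero, PMF.pure_bind, coinsC_run, constC_run, PMF.pure_map, PMF.bind_pure,
    PMF.bind_apply, lazyC_run, List.append_assoc]

theorem measurable_queryProb (T : List Bool) (es : List Gate) (M : Memory) :
    Measurable fun H : Hash k => queryProb H.toOracle T es M := by
  simp only [queryProb_eq_sum]
  exact Finset.measurable_sum _ fun j _ => measurable_runGates _ _ _ _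

theorem tsum_uniform_bxor (m : Bits k) (f : Bits k → ENNReal) :
    ∑' u, PMF.uniformOfFintype (Bits k) u * f (bxor u m) =
      ∑' u, PMF.uniformOfFintype (Bits k) u * f u := by
  rw [← (bxorEquiv m).tsum_eq fun u => PMF.uniformOfFintype (Bits k) u * f u]
  simp only [PMF.uniformOfFintype_apply]
  rfl

/-- If an input bit string is masked by the value of the random oracle at `T`, the mask may be
replaced by a random string up to the probability that `T` is queried. -/
theorem lintegral_mask (E : Circuit) {ℓ : ℕ} (tail : List Bool) (m : Bits k) {z : List Bool}
    (hz : z.length = ℓ) (T v : List Bool) :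
    let R := ∫⁻ H : Hash k, E.run H.toOracle (z ++ List.ofFn (bxor (H T) m) ++ tail) v
      ∂randomOracle k
    let S := ∑' u, PMF.uniformOfFintype (Bits k) u *
      ∫⁻ H : Hash k, E.run H.toOracle (z ++ List.ofFn u ++ tail) v ∂randomOracle k
    let B := ∑ j, (attackC k ℓ tail E j).run noOracle z T
    R ≤ S + B ∧ S ≤ R + B := by
  intro R S B
  let w : Bits k → List Bool := fun u => z ++ List.ofFn u ++ tail
  -- the value of the oracle at `T` is resampled, so that the mask is the fresh value
  have hR : R = ∑' u, PMF.uniformOfFintype (Bits k) u * ∫⁻ H : Hash k,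
      E.run (Hash.toOracle (Function.update H T u)) (w (bxor u m)) v ∂randomOracle k := by
    have := lintegral_randomOracle_update (k := k)
      (f := fun H => E.run H.toOracle (w (bxor (H T) m)) v)
      (measurable_eval_hash (f := fun u H => E.run H.toOracle (w (bxor u m)) v)
        (fun u => measurable_run _ _ _) T) T
    simpa only [Function.update_self] using this
  have hS : S = ∑' u, PMF.uniformOfFintype (Bits k) u *
      ∫⁻ H : Hash k, E.run H.toOracle (w (bxor u m)) v ∂randomOracle k :=
    (tsum_uniform_bxor m _).symm
  have hB : B = ∑' u, PMF.uniformOfFintype (Bits k) u * ∫⁻ H : Hash k,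
      queryProb H.toOracle T E.gates (Memory.load (w (bxor u m))) ∂randomOracle k := by
    rw [tsum_uniform_bxor m fun u => ∫⁻ H : Hash k,
      queryProb H.toOracle T E.gates (Memory.load (w u)) ∂randomOracle k]
    simp only [B, attackC_run tail E _ hz]
    rw [← Summable.tsum_finsetSum fun _ _ => ENNReal.summable]
    refine tsum_congr fun u => ?_
    rw [← Finset.mul_sum]
    simp only [queryProb_eq_sum]
    rw [lintegral_finsetSum _ fun j _ => measurable_runGates _ _ _ _]
  have hagree : ∀ (H : Hash k) (u : Bits k) (q : List Bool), q ≠ T →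
      H.toOracle q = Hash.toOracle (Function.update H T u) q := fun H u q hq => by
    simp [Hash.toOracle, Function.update_of_ne hq]
  have hmq := fun u => measurable_queryProb (k := k) T E.gates (Memory.load (w u))
  rw [hR, hS, hB, ← ENNReal.tsum_add, ← ENNReal.tsum_add]
  constructor
  · refine ENNReal.tsum_le_tsum fun u => ?_
    rw [← mul_add, ← lintegral_add_right _ (hmq _)]
    exact mul_le_mul_right (lintegral_mono fun H =>
      (runGates_le_add_queryProb (hagree H u) E.gates _ _ v).2) _
  · refine ENNReal.tsum_le_tsum fun u => ?_
    rw [← mul_add, ← lintegral_add_right _ (hmq _)]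
    exact mul_le_mul_right (lintegral_mono fun H =>
      (runGates_le_add_queryProb (hagree H u) E.gates _ _ v).1) _

theorem map_decide_apply {α : Type*} [DecidableEq α] (p : PMF α) (T : α) :
    (p.map fun out => decide (out = T)) true = p T := by
  rw [PMF.map_apply, tsum_eq_single T fun b hb => by simp [hb]]
  simp

/-- `lintegral_mask` for a random instance `(z, T)` of a search problem. -/
theorem lintegral_mask_challenge (p : PMF (List Bool × List Bool)) {ℓ : ℕ}
    (hp : ∀ z ∈ p.support, z.1.length = ℓ) (E : Circuit) (tail : List Bool) (m : Bits k)
    (v : List Bool) :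
    let R := ∫⁻ H : Hash k, (p.bind fun z =>
      E.run H.toOracle (z.1 ++ List.ofFn (bxor (H z.2) m) ++ tail)) v ∂randomOracle k
    let S := ∫⁻ H : Hash k, (p.bind fun z => (PMF.uniformOfFintype (Bits k)).bind fun u =>
      E.run H.toOracle (z.1 ++ List.ofFn u ++ tail)) v ∂randomOracle k
    let B := ∑ j, (p.bind fun z => ((attackC k ℓ tail E j).run noOracle z.1).map
      fun out => decide (out = z.2)) true
    R ≤ S + B ∧ S ≤ R + B := by
  intro R S B
  have hR : R = ∑' z, p z * ∫⁻ H : Hash k,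
      E.run H.toOracle (z.1 ++ List.ofFn (bxor (H z.2) m) ++ tail) v ∂randomOracle k :=
    lintegral_bind _ _ fun z => measurable_eval_hash
      (f := fun u H => E.run H.toOracle (z.1 ++ List.ofFn (bxor u m) ++ tail) v)
      (fun u => measurable_run _ _ _) z.2
  have hS : S = ∑' z, p z * ∑' u, PMF.uniformOfFintype (Bits k) u *
      ∫⁻ H : Hash k, E.run H.toOracle (z.1 ++ List.ofFn u ++ tail) v ∂randomOracle k := by
    refine (lintegral_bind _ _ fun z => measurable_bind _ _ fun u => measurable_run _ _ _).trans ?_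
    exact tsum_congr fun z => congrArg _ (lintegral_bind _ _ fun u => measurable_run _ _ _)
  have hB : B = ∑' z, p z * ∑ j, (attackC k ℓ tail E j).run noOracle z.1 z.2 := by
    simp only [B, PMF.bind_apply, map_decide_apply, Finset.mul_sum]
    rw [Summable.tsum_finsetSum fun _ _ => ENNReal.summable]
  rw [hR, hS, hB, ← ENNReal.tsum_add, ← ENNReal.tsum_add]
  constructor
  all_goals
    refine ENNReal.tsum_le_tsum fun z => ?_
    rw [← mul_add]
    by_cases hz : p z = 0
    · simp [hz]
    have h := lintegral_mask E tail m (hp z ((PMF.mem_support_iff _ _).2 hz)) z.2 v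
  · exact mul_le_mul_right h.1 _
  · exact mul_le_mul_right h.2 _

end Hybrid

/-! ### Computational indistinguishability -/

theorem acceptProb_mem {k : ℕ} (D : Circuit) (X : Hash k → PMF (List Bool)) :
    0 ≤ acceptProb D X ∧ acceptProb D X ≤ 1 := by
  refine ⟨ENNReal.toReal_nonneg, ?_⟩
  refine ENNReal.toReal_le_of_le_ofReal zero_le_one ?_
  rw [ENNReal.ofReal_one]
  refine (lintegral_mono fun H => PMF.coe_le_one _ _).trans ?_
  simp

theorem negligible_of_two_le {μ ν : ℕ → ℝ} (hμ : Negligible μ) (h : ∀ n, 2 ≤ n → ν n = μ n) :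
    Negligible ν :=
  Asymptotics.SuperpolynomialDecay.congr' hμ <|
    (Filter.eventually_ge_atTop 2).mono fun n hn => (h n hn).symm

/-- It suffices to bound the advantage for security parameters at least two. For the others the order
of the group is not bounded by `2 ^ n`, and exponents do not fit into `n` bits. -/
theorem compIndist_of_two_le {σ : ℕ → ℕ} {ι : ℕ → Type}
    {X Y : ∀ n, ι n → Hash (σ n) → PMF (List Bool)}
    (h : ∀ D : ℕ → Circuit, IsPPT D → ∃ μ : ℕ → ℝ, Negligible μ ∧ ∀ n (i : ι n), 2 ≤ n →
      |acceptProb (D n) (X n i) - acceptProb (D n) (Y n i)| ≤ μ n) : CompIndist σ X Y := by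
  intro D hD
  obtain ⟨μ, hμ, hle⟩ := h D hD
  refine ⟨fun n => if 2 ≤ n then μ n else 1, negligible_of_two_le hμ fun n hn => if_pos hn,
    fun n i => ?_⟩
  simp only
  split_ifs with hn
  · exact hle n i hn
  · obtain ⟨h1, h2⟩ := acceptProb_mem (D n) (X n i)
    obtain ⟨h3, h4⟩ := acceptProb_mem (D n) (Y n i)
    rw [abs_le]
    constructor <;> linarith

theorem compIndist_of_eq {σ : ℕ → ℕ} {ι : ℕ → Type}
    {X Y : ∀ n, ι n → Hash (σ n) → PMF (List Bool)}
    (h : ∀ n, 2 ≤ n → ∀ i H, X n i H = Y n i H) : CompIndist σ X Y := by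
  refine compIndist_of_two_le fun D _ => ⟨fun _ => 0,
    Asymptotics.superpolynomialDecay_zero _ _, fun n i hn => ?_⟩
  have : X n i = Y n i := funext (h n hn i)
  simp [this]

/-- Non-uniformity: from finitely many circuits for each security parameter, the best one can be
chosen. -/
theorem exists_best {κ : ℕ → Type} [∀ n, Finite (κ n)] (A : ∀ n, κ n → Circuit) {f : ℕ → ℕ}
    (hf : PolyBounded f) (hA : ∀ n i, (A n i).size ≤ f n) (val : ℕ → Circuit → ℝ) :
    ∃ B : ℕ → Circuit, IsPPT B ∧ ∀ n i, val n (A n i) ≤ val n (B n) := by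
  have key : ∀ n, ∃ B : Circuit, B.size ≤ f n ∧ ∀ i, val n (A n i) ≤ val n B := by
    intro n
    rcases isEmpty_or_nonempty (κ n) with h | h
    · exact ⟨⟨[], 0⟩, Nat.zero_le _, fun i => h.elim i⟩
    · obtain ⟨i, hi⟩ := Finite.exists_max fun i => val n (A n i)
      exact ⟨A n i, hA n i, hi⟩
  choose B hB using key
  exact ⟨B, hf.mono fun n => (hB n).1, fun n => (hB n).2⟩

theorem negligible_polyBounded_mul {f : ℕ → ℕ} (hf : PolyBounded f) {μ : ℕ → ℝ}
    (hμ : Negligible μ) : Negligible fun n => f n * μ n := by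
  obtain ⟨P, hP⟩ := hf
  refine Asymptotics.SuperpolynomialDecay.trans_abs_le
    (Asymptotics.SuperpolynomialDecay.polynomial_mul hμ (P.map (Nat.castRingHom ℝ))) fun n => ?_
  have h1 : ((P.map (Nat.castRingHom ℝ)).eval (n : ℝ)) = ((P.eval n : ℕ) : ℝ) := by
    rw [Polynomial.eval_natCast_map]; rfl
  rw [h1, abs_mul, abs_mul, Nat.abs_cast, Nat.abs_cast]
  exact mul_le_mul_of_nonneg_right (by exact_mod_cast hP n) (abs_nonneg _)

/-! ### Simulation of the receiver -/

section SimR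

variable (G : GroupGen) (σ : ℕ → ℕ)

/-- The program of the simulator of `R`. It draws a Diffie–Hellman instance and computes the
view with a random string in place of the masked message that `R` cannot open. -/
noncomputable def simRF : FProg := genF G ++
  [([4], belowC), ([3, 5, 6], G.powC), ([4], belowC), ([3, 5, 8], G.powC),
    ([], fun n => coinsC (σ n)), ([2, 7, 9, 10, 0], recvC G σ)]

variable {G σ}

theorem isPPT_simRF (hσ : PolyBounded σ) : ∀ e ∈ simRF G σ, IsPPT e.2 := by
  refine List.forall_mem_append.2 ⟨isPPT_genF G, ?_⟩
  simp only [List.mem_cons, List.not_mem_nil, or_false, forall_eq_or_imp, forall_eq]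
  exact ⟨isPPT_belowC, G.isPPT_powC, isPPT_belowC, G.isPPT_powC, isPPT_coinsC hσ, isPPT_recvC hσ⟩

theorem simR_run {n : ℕ} (hn : 2 ≤ n) (O : Oracle) (w : List Bool) {ℓ : ℕ} (hw : w.length = ℓ) :
    (((simRF G σ).at n).circuit ℓ [11]).run O w = (dhChallenge G n).bind fun z =>
      (PMF.uniformOfFintype (Bits (σ n))).bind fun u =>
        (recvC G σ n).run O (z.1 ++ List.ofFn u ++ w) := by
  rw [Prog.circuit_run O _ _ _ hw, simRF, genF_eval]
  simp only [FProg.at, List.map_cons, List.map_nil, Prog.eval, gather, List.flatMap_cons,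
    List.flatMap_nil, List.append_nil, PMF.bind_map, PMF.map_bind, Function.comp_def,
    List.cons_append, List.nil_append, List.getD_cons_succ, List.getD_cons_zero,
    PMF.pure_bind, G.belowC_run O hn, G.powC_run O hn, coinsC_run, PMF.pure_map, PMF.bind_pure,
    dhChallenge, PMF.bind_bind, List.append_assoc]

theorem view_R_eq_recvC {n : ℕ} (hn : 2 ≤ n) (H : Hash (σ n)) (m : Messages (σ n)) (s : Bool) :
    view G σ n .R m s H = (dhChallenge G n).bind fun z => (recvC G σ n).run H.toOracle
      (z.1 ++ List.ofFn (bxor (H z.2) (m !s)) ++ (s :: List.ofFn (m s))) := by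
  rw [view, view_R_eq]
  simp only [dhChallenge, PMF.bind_bind, PMF.pure_bind, recvC_run hn]

variable (G) in
/-- The length of the strings in a Diffie–Hellman instance. -/
def dhLen (n : ℕ) : ℕ := G.descLen n + n + G.eltLen n + G.eltLen n + G.eltLen n

theorem length_of_mem_dhChallenge {n : ℕ} {z : List Bool × List Bool}
    (hz : z ∈ (dhChallenge G n).support) : z.1.length = dhLen G n := by
  simp only [dhChallenge, PMF.mem_support_bind_iff, PMF.mem_support_pure_iff] at hz
  obtain ⟨ρ, -, a, -, b, -, rfl⟩ := hz
  simp [dhLen, add_assoc]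

variable (G σ) in
/-- The program that computes a view of `R` and runs a distinguisher on it. -/
noncomputable def gameF (D : ℕ → Circuit) : FProg := [([0], recvC G σ), ([1], D)]

variable (G σ) in
/-- The circuits for `gameF`. -/
noncomputable def gameC (D : ℕ → Circuit) (n : ℕ) : Circuit :=
  ((gameF G σ D).at n).circuit (dhLen G n + σ n + (1 + σ n)) [2]

theorem dhLen_poly : PolyBounded (dhLen G) :=
  .add (.add (.add (.add G.descLen_poly .id) G.eltLen_poly) G.eltLen_poly) G.eltLen_poly

theorem isPPT_gameC (hσ : PolyBounded σ) {D : ℕ → Circuit} (hD : IsPPT D) :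
    IsPPT (gameC G σ D) := by
  refine FProg.isPPT ?_ (.add (.add dhLen_poly hσ) (.add (.const 1) hσ))
  simp only [gameF, List.mem_cons, List.not_mem_nil, or_false, forall_eq_or_imp, forall_eq]
  exact ⟨isPPT_recvC hσ, hD⟩

theorem gameC_run (O : Oracle) (D : ℕ → Circuit) (n : ℕ) {w : List Bool}
    (hw : w.length = dhLen G n + σ n + (1 + σ n)) :
    (gameC G σ D n).run O w = ((recvC G σ n).run O w).bind ((D n).run O) := by
  rw [gameC, Prog.circuit_run O _ _ _ hw]
  simp only [gameF, FProg.at, List.map_cons, List.map_nil, Prog.eval, gather, List.flatMap_cons,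
    List.flatMap_nil, List.append_nil, PMF.map_bind, List.cons_append, List.nil_append,
    List.getD_cons_succ, List.getD_cons_zero, PMF.pure_map, PMF.bind_pure]

theorem bind_congr_support {α β : Type*} (p : PMF α) {f g : α → PMF β}
    (h : ∀ a ∈ p.support, f a = g a) : p.bind f = p.bind g := by
  ext b
  simp only [PMF.bind_apply]
  refine tsum_congr fun a => ?_
  by_cases ha : p a = 0
  · simp [ha]
  · rw [h a ((PMF.mem_support_iff _ _).2 ha)]

theorem querySrc_length_le {es : List Gate} {e : Gate} (he : e ∈ es) :
    e.querySrc.length ≤ gatesSize es := by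
  have h1 : e.querySrc.length ≤ e.size := by
    cases e <;> simp [Gate.querySrc, Gate.size]
  exact h1.trans (List.le_sum_of_mem (List.mem_map_of_mem he))

theorem attackC_size_le (k ℓ : ℕ) (tail : List Bool) (E : Circuit) (j : Fin E.gates.length) :
    (attackC k ℓ tail E j).size ≤ (6 + 3 * k) + 11 * tail.length +
      (18 * E.size + E.size * lazyCost k E.size) +
      17 * (4 * (ℓ + (k + tail.length + E.size))) := by
  have h1 := Prog.circuit_size_le [([], coinsC k), ([], constC tail),
    ([0, 1, 2], lazyC k (E.gates.take j) E.gates[j].querySrc)] ℓ [3]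
  have h2 := coinsC_size k
  have h3 := constC_size tail
  have h4 : gatesSize E.gates ≤ E.size := by rw [Circuit.size_eq]; exact Nat.le_add_left _ _
  have h5 : gatesSize (E.gates.take j) ≤ E.size := by
    have := congrArg gatesSize (List.take_append_drop j E.gates)
    rw [gatesSize_append] at this
    omega
  have h6 : E.gates[j].querySrc.length ≤ E.size :=
    (querySrc_length_le (List.getElem_mem j.isLt)).trans h4
  have h7 := lazyC_size_le (k := k) _ _ _ h5 h6
  have h8 : (lazyC k (E.gates.take j) E.gates[j].querySrc).outLen ≤ E.size := h6
  have h9 : (coinsC k).outLen = k := rfl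
  have h10 : (constC tail).outLen = tail.length := by simp [constC, formC]
  simp only [List.map_cons, List.map_nil, List.sum_cons, List.sum_nil, List.length_cons,
    List.length_nil, h9, h10] at h1
  rw [attackC]
  omega

/-- Under CDH the simulated and the real view of `R` are indistinguishable. The reduction depends on
the inputs of the parties and on a gate of the game, and the best choice is hard-wired. -/
theorem simR_indist (hσ : PolyBounded σ) (hCDH : G.CDHHard) :
    CompIndist σ (ι := fun n => Messages (σ n) × Bool)
      (fun n i H => (((simRF G σ).at n).circuit (1 + σ n) [11]).run H.toOracle
        (partyInput i.1 i.2 .R ++ functionality i.1 i.2 .R))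
      (fun n i H => view G σ n .R i.1 i.2 H) := by
  refine compIndist_of_two_le fun D hD => ?_
  have hE := isPPT_gameC (G := G) hσ hD
  obtain ⟨B, hB, hbest⟩ := exists_best
    (κ := fun n => (Messages (σ n) × Bool) × Fin (gameC G σ D n).gates.length)
    (fun n x => attackC (σ n) (dhLen G n) (x.1.2 :: List.ofFn (x.1.1 x.1.2)) (gameC G σ D n) x.2)
    (f := fun n => (6 + 3 * σ n) + 11 * (σ n + 1) +
      (18 * (gameC G σ D n).size + (gameC G σ D n).size * lazyCost (σ n) (gameC G σ D n).size) +
      17 * (4 * (dhLen G n + (σ n + (σ n + 1) + (gameC G σ D n).size))))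
    (by
      have hc : PolyBounded fun n => lazyCost (σ n) (gameC G σ D n).size :=
        .add (.add (.add (.const_mul 8 hE) (.add (.const_mul 2 hσ) (.const 6)))
          (.mul hσ (.add (.const 8) (.mul hE (.add (.const 50) (.const_mul 200 hE))))))
          (.const_mul 8 hσ)
      exact .add (.add (.add (.add (.const 6) (.const_mul 3 hσ))
        (.const_mul 11 (.add hσ (.const 1)))) (.add (.const_mul 18 hE) (.mul hE hc)))
        (.const_mul 17 (.const_mul 4 (.add dhLen_poly (.add (.add hσ (.add hσ (.const 1))) hE)))))
    (fun n x => by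
      have := attackC_size_le (σ n) (dhLen G n) (x.1.2 :: List.ofFn (x.1.1 x.1.2))
        (gameC G σ D n) x.2
      simpa only [List.length_cons, List.length_ofFn] using this)
    (fun n A => G.cdhSuccess A n)
  refine ⟨_, negligible_polyBounded_mul hE (hCDH B hB), fun n i hn => ?_⟩
  obtain ⟨m, s⟩ := i
  have key := lintegral_mask_challenge (k := σ n) (dhChallenge G n)
    (fun z hz => length_of_mem_dhChallenge hz) (gameC G σ D n) (s :: List.ofFn (m s)) (m !s) [true]
  have hlen : ∀ z ∈ (dhChallenge G n).support, ∀ u : Bits (σ n),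
      (z.1 ++ List.ofFn u ++ (s :: List.ofFn (m s))).length = dhLen G n + σ n + (1 + σ n) := by
    intro z hz u
    simp [length_of_mem_dhChallenge hz]; omega
  have hX : ∀ H : Hash (σ n), ((((simRF G σ).at n).circuit (1 + σ n) [11]).run H.toOracle
      (partyInput m s .R ++ functionality m s .R)).bind (fun v => (D n).run H.toOracle v) =
      (dhChallenge G n).bind fun z => (PMF.uniformOfFintype (Bits (σ n))).bind fun u =>
        (gameC G σ D n).run H.toOracle (z.1 ++ List.ofFn u ++ (s :: List.ofFn (m s))) := by
    intro H
    rw [simR_run hn _ _ (by simp [partyInput, functionality]; omega), PMF.bind_bind]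
    refine bind_congr_support _ fun z hz => ?_
    rw [PMF.bind_bind]
    congr 1
    funext u
    rw [gameC_run _ _ _ (hlen z hz u)]
    rfl
  have hY : ∀ H : Hash (σ n), (view G σ n .R m s H).bind (fun v => (D n).run H.toOracle v) =
      (dhChallenge G n).bind fun z => (gameC G σ D n).run H.toOracle
        (z.1 ++ List.ofFn (bxor (H z.2) (m !s)) ++ (s :: List.ofFn (m s))) := by
    intro H
    rw [view_R_eq_recvC hn, PMF.bind_bind]
    refine bind_congr_support _ fun z hz => ?_
    rw [gameC_run _ _ _ (hlen z hz _)]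
  have hadv : (∑ j, ((dhChallenge G n).bind fun z => ((attackC (σ n) (dhLen G n)
      (s :: List.ofFn (m s)) (gameC G σ D n) j).run noOracle z.1).map
        fun out => decide (out = z.2)) true).toReal ≤
      (gameC G σ D n).size * G.cdhSuccess (B n) n := by
    rw [ENNReal.toReal_sum fun j _ => PMF.apply_ne_top _ _]
    have h1 : ∀ j ∈ (Finset.univ : Finset (Fin (gameC G σ D n).gates.length)), _ ≤ _ :=
      fun j _ => hbest n ((m, s), j)
    simp only [cdhSuccess_eq] at h1 ⊢
    refine (Finset.sum_le_card_nsmul _ _ _ h1).trans ?_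
    rw [Finset.card_univ, Fintype.card_fin, nsmul_eq_mul]
    refine mul_le_mul_of_nonneg_right ?_ ENNReal.toReal_nonneg
    exact_mod_cast (length_le_gatesSize _).trans (by rw [Circuit.size_eq]; exact Nat.le_add_left _ _)
  refine le_trans ?_ hadv
  simp only [acceptProb, hX, hY]
  have hfin : ∀ X : Hash (σ n) → PMF (List Bool),
      ∫⁻ H, X H [true] ∂randomOracle (σ n) ≠ ⊤ := fun X => by
    refine ne_top_of_le_ne_top ENNReal.one_ne_top
      ((lintegral_mono fun H => PMF.coe_le_one _ _).trans ?_)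
    simp
  have hsum : (∑ j, ((dhChallenge G n).bind fun z => ((attackC (σ n) (dhLen G n)
      (s :: List.ofFn (m s)) (gameC G σ D n) j).run noOracle z.1).map
        fun out => decide (out = z.2)) true) ≠ ⊤ :=
    ENNReal.sum_ne_top.2 fun j _ => PMF.apply_ne_top _ _
  have h1 := ENNReal.toReal_mono (ENNReal.add_ne_top.2 ⟨hfin _, hsum⟩) key.1
  have h2 := ENNReal.toReal_mono (ENNReal.add_ne_top.2 ⟨hfin _, hsum⟩) key.2
  rw [ENNReal.toReal_add (hfin _) hsum] at h1 h2
  rw [abs_le]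
  constructor <;> linarith

end SimR

theorem realizes (G : GroupGen) (σ : ℕ → ℕ) (hσ : PolyBounded σ) (hCDH : G.CDHHard) :
    Realizes σ (view G σ) := by
  intro P
  cases P with
  | S =>
    refine ⟨fun n => ((simSF G).at n).circuit (σ n + σ n) [0, 1, 6, 8, 9, 2, 7, 11, 13],
      FProg.isPPT (isPPT_simSF G) (hσ.add hσ), compIndist_of_eq fun n hn i H => ?_⟩
    have := simS_run (G := G) hn H.toOracle H i.1 i.2 _ rfl
    simpa [partyInput, functionality, view] using this
  | P₁ =>
    refine ⟨fun n => ((simP₁F G).at n).circuit 0 [2, 7, 8, 9, 11, 13],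
      FProg.isPPT (isPPT_simP₁F G) (.const 0), compIndist_of_eq fun n hn i H => ?_⟩
    exact simP₁_run (G := G) hn H.toOracle H i.1 i.2 []
  | P₂ =>
    refine ⟨fun n => ((simP₂F G).at n).circuit 0 [2, 7, 8, 9],
      FProg.isPPT (isPPT_simP₂F G) (.const 0), compIndist_of_eq fun n hn i H => ?_⟩
    exact simP₂_run (G := G) hn H.toOracle H i.1 i.2 []
  | R =>
    exact ⟨fun n => ((simRF G σ).at n).circuit (1 + σ n) [11],
      FProg.isPPT (isPPT_simRF hσ) (.add (.const 1) hσ), simR_indist hσ hCDH⟩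

end DQOT

theorem mainTheorem2 (G : DQOT.GroupGen) (σ : ℕ → ℕ) (hσ : DQOT.PolyBounded σ)
    (hDL : G.DLHard) (hCDH : G.CDHHard) :
    DQOT.Correct G σ ∧ DQOT.Realizes σ (DQOT.view G σ) :=
  ⟨DQOT.correct G σ, DQOT.realizes G σ hσ hCDH⟩
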